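/- Let $\eta>0$. Consider the two-periodic zero-sum game with payoff matrices $A_t=\begin{pmatrix}0&1\\1&0\end{pmatrix}$ for odd $t$ and $A_t=\begin{pmatrix}0&-1\\-1&0\end{pmatrix}$ for even $t$, whose equilibrium is $x_1^*=x_2^*=(\tfrac12,\tfrac12)$, and Optimistic Multiplicative Weights Update with step size $\eta$: for $t\ge 0$ and $s\in\{1,2\}$, $$x_{1,s}^{t+1}\propto x_{1,s}^t\,e^{2\eta(A_tx_2^t)_s-\eta(A_{t-1}x_2^{t-1})_s},\qquad x_{2,s}^{t+1}\propto x_{2,s}^t\,e^{-2\eta(A_t^\top x_1^t)_s+\eta(A_{t-1}^\top x_1^{t-1})_s},$$ normalized so that $x_i^{t+1}\in\Delta_2$, where $x_1^{-1},x_2^{-1}\in\Delta_2$ are arbitrary and $x_1^0,x_2^0\in\Delta_2$ have positive entries. Put $z^n=(x_{1,1}^{n-1},x_{1,1}^{n},x_{2,1}^{n-1},x_{2,1}^{n})$ and, with $\sigma(p,q)=\frac{pe^{q}}{pe^{q}+(1-p)e^{-q}}$, let $$G_1(z)=\bigl(z_2,\ \sigma(z_2,\tfrac{3\eta}{2}-2\eta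 z_4-\eta z_3),\ z_4,\ \sigma(z_4,-\tfrac{3\eta}{2}+2\eta z_2+\eta z_1)\bigr),$$ $$G_2(z)=\bigl(z_2,\ \sigma(z_2,-\tfrac{3\eta}{2}+2\eta z_4+\eta z_3),\ z_4,\ \sigma(z_4,\tfrac{3\eta}{2}-2\eta z_2-\eta z_1)\bigr),$$ so that $G_2$ maps $z^n$ to $z^{n+1}$ for even $n\ge0$, and $G_1$ does so for odd $n$. Let $\varphi(a)=\frac{ae^{-3\eta}}{ae^{-3\eta}+1-a}$, and let $\mathrm{KL}(x^*,x^t)=\sum_{i=1}^2\sum_{s=1}^2 x^*_{i,s}\ln(x^*_{i,s}/x^t_{i,s})$. Then $z^{n+2}=(G_1\circ G_2)(z^n)$ for every even $n\ge 0$, and the following holds for each player $i$ and pure strategy $s$, with the family $p_a$ given by $(0,0,a,\varphi(a))$ for $(i,s)=(1,1)$, $(1,1,1-a,1-\varphi(a))$ for $(1,2)$, $(1-a,1-\varphi(a),0,0)$ for $(2,1)$, and $(a,\varphi(a),1,1)$ for $(2,2)$. 1. For every $a\in[0,1]$, $p_a$ is a fixed point of $G_1\circ G_2$. 2. For every $a\in(0,1)$,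 $G_1\circ G_2$ is differentiable at $p_a$ and the eigenvalues of its Jacobian matrix there, with algebraic multiplicity, are $0,0,1,\lambda$ with $\lambda=\exp\bigl(-\frac{2\eta a(1-a)(e^{3\eta}-1)}{a+(1-a)e^{3\eta}}\bigr)\in(0,1)$. 3. For every $\varepsilon>0$ there is $\delta>0$ such that, for every trajectory and every even $n\ge2$, if $x_{i,s}^{n-1},x_{i,s}^{n}<\delta$, then $z^n$ is within $\varepsilon$ of $p_a$ for some $a\in(0,1)$. 4. For every $a\in(0,1)$ there is $\rho>0$ such that for every $z\in[0,1]^4$ within $\rho$ of $p_a$, the two entries of $(G_1\circ G_2)^t(z)$ that belong to player $i$ converge, as $t\to\infty$, to their common value in $p_a$ ($0$ if $s=1$, $1$ if $s=2$). 5. For every $\kappa>0$ there is $\delta>0$ such that, for every trajectory and every $n\ge0$, if $x_{i,s}^{n-1},x_{i,s}^n<\delta$ and both probabilities of the other player at time $n$ are at least $\kappa$, then $x_{i,s}^t\to0$ and $\mathrm{KL}(x^*,x^t)\to\infty$ as $t\to\infty$. 6. There is $\delta>0$ such that, for every trajectory and every $n\ge0$, if $x_{i,s}^{n-1},x_{i,s}^n<\delta$,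 then at least one of the players converges to the boundary ($x_{i,s}^t\to0$, or $x_{j,s'}^t\to0$ for the other player $j$ and some $s'$), and $\mathrm{KL}(x^*,x^t)\to\infty$ as $t\to\infty$. -/

import Mathlib

open Filter Topology Polynomial

noncomputable section

namespace PeriodicOMWU

/-- The two-periodic zero-sum game: the payoff matrix (of the first player, who maximizes) at
time `t`. -/
def payoff (t : ℤ) : Matrix (Fin 2) (Fin 2) ℝ :=
  if Even t then !![0, -1; -1, 0] else !![0, 1; 1, 0]

/-- One multiplicative-weights step: weights `w` are reweighted by `exp (g s)` and normalized. -/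
def mwStep (w g : Fin 2 → ℝ) (s : Fin 2) : ℝ :=
  w s * Real.exp (g s) / ∑ r, w r * Real.exp (g r)

/-- `x t i s` is the probability that player `i` gives to pure strategy `s` at time `t ≥ -1`
(values at times below `-1` are irrelevant).  The sequence is a trajectory of Optimistic
Multiplicative Weights Update with step size `η` in the periodic game; the initial pair consists
of an arbitrary mixed profile at time `-1` and a fully mixed profile at time `0`. -/
structure IsOMWU (η : ℝ) (x : ℤ → Fin 2 → Fin 2 → ℝ) : Prop where
  prev_mem : ∀ i, x (-1) i ∈ stdSimplex ℝ (Fin 2)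
  init_mem : ∀ i, x 0 i ∈ stdSimplex ℝ (Fin 2)
  init_pos : ∀ i s, 0 < x 0 i s
  step_fst : ∀ t : ℤ, 0 ≤ t → x (t + 1) 0 =
    mwStep (x t 0) (fun s =>
      2 * η * (payoff t).mulVec (x t 1) s - η * (payoff (t - 1)).mulVec (x (t - 1) 1) s)
  step_snd : ∀ t : ℤ, 0 ≤ t → x (t + 1) 1 =
    mwStep (x t 1) (fun s =>
      -(2 * η * (payoff t).transpose.mulVec (x t 0) s)
        + η * (payoff (t - 1)).transpose.mulVec (x (t - 1) 0) s)

/-- The unique equilibrium, common to both stage games: both players mix uniformly. -/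
def equilibrium : Fin 2 → Fin 2 → ℝ := fun _ _ => 1 / 2

/-- Kullback–Leibler divergence of two strategy profiles, summed over the two players. -/
def KL (p q : Fin 2 → Fin 2 → ℝ) : ℝ :=
  ∑ i, ∑ s, p i s * Real.log (p i s / q i s)

/-- The iterate vector at time `n`: the probabilities of the first pure strategy of each player
at times `n - 1` and `n`. -/
def iterVec (x : ℤ → Fin 2 → Fin 2 → ℝ) (n : ℤ) : Fin 4 → ℝ :=
  ![x (n - 1) 0 0, x n 0 0, x (n - 1) 1 0, x n 1 0]

/-- Position in the iterate vector of the entry of player `i` at time `n - 1` (`r = 0`) or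
`n` (`r = 1`). -/
def coord (i r : Fin 2) : Fin 4 := ![![0, 1], ![2, 3]] i r

/-- The map that advances the iterate vector by one step, from an even time `t`:
`(x₁ᵗ, x₁ᵗ⁺¹, x₂ᵗ, x₂ᵗ⁺¹) ↦ (x₁ᵗ⁺¹, x₁ᵗ⁺², x₂ᵗ⁺¹, x₂ᵗ⁺²)`. -/
def G₁ (η : ℝ) (z : Fin 4 → ℝ) : Fin 4 → ℝ :=
  ![z 1,
    z 1 * Real.exp (3 * η - 2 * η * z 3 - η * z 2) /
      (z 1 * Real.exp (3 * η - 2 * η * z 3 - η * z 2)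
        + (1 - z 1) * Real.exp (2 * η * z 3 + η * z 2)),
    z 3,
    z 3 * Real.exp (-3 * η + 2 * η * z 1 + η * z 0) /
      (z 3 * Real.exp (-3 * η + 2 * η * z 1 + η * z 0)
        + (1 - z 3) * Real.exp (-2 * η * z 1 - η * z 0))]

/-- The same for odd `t`. -/
def G₂ (η : ℝ) (z : Fin 4 → ℝ) : Fin 4 → ℝ :=
  ![z 1,
    z 1 * Real.exp (-3 * η + 2 * η * z 3 + η * z 2) /
      (z 1 * Real.exp (-3 * η + 2 * η * z 3 + η * z 2)
        + (1 - z 1) * Real.exp (-2 * η * z 3 - η * z 2)),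
    z 3,
    z 3 * Real.exp (3 * η - 2 * η * z 1 - η * z 0) /
      (z 3 * Real.exp (3 * η - 2 * η * z 1 - η * z 0)
        + (1 - z 3) * Real.exp (2 * η * z 1 + η * z 0))]

/-- `a e^{-3η} / (a e^{-3η} + 1 - a)`. -/
def shift (η a : ℝ) : ℝ :=
  a * Real.exp (-3 * η) / (a * Real.exp (-3 * η) + (1 - a))

/-- The point with parameter `a` of the family of fixed points on the face where player `i` does
not use strategy `s`.  For `i = s = 0` it is `(0, 0, a, shift η a)`; the other three are the
images under the order-four symmetry `(z₁, z₂, z₃, z₄) ↦ (1 - z₃, 1 - z₄, z₁, z₂)`. -/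
def facePoint (η : ℝ) (i s : Fin 2) (a : ℝ) : Fin 4 → ℝ :=
  (![![![0, 0, a, shift η a], ![1, 1, 1 - a, 1 - shift η a]],
     ![![1 - a, 1 - shift η a, 0, 0], ![a, shift η a, 1, 1]]] :
    Fin 2 → Fin 2 → Fin 4 → ℝ) i s

/-- The Jacobian matrix of `f` at `z`. -/
def jacobian (f : (Fin 4 → ℝ) → (Fin 4 → ℝ)) (z : Fin 4 → ℝ) : Matrix (Fin 4) (Fin 4) ℝ :=
  LinearMap.toMatrix' (fderiv ℝ f z : (Fin 4 → ℝ) →ₗ[ℝ] (Fin 4 → ℝ))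

/-- The fourth eigenvalue of the Jacobian at the fixed point with parameter `a`. -/
def fourthEigenvalue (η a : ℝ) : ℝ :=
  Real.exp (-(2 * η * a * (1 - a) * (Real.exp (3 * η) - 1) / (a + (1 - a) * Real.exp (3 * η))))

end PeriodicOMWU

end

/-!
In terms of the log-odds of the two strategies, every step of the algorithm is a translation, and
`G₂` is `G₁` with the sign of `η` reversed.  While player `0` hardly uses strategy `0`, the
log-odds of the opponent are raised by about `3η` in one step and lowered again in the next, so
the opponent stays put after two steps.  Because the update is optimistic, this oscillation lowers
the log-odds of player `0` in every round of two steps by at least a constant times the variance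
of the opponent's strategy.  If the sum of these variances diverges, player `0` converges to the
face.  If it converges, the strategies of the opponent form a Cauchy sequence, whose limit has
variance zero, so the opponent converges to the boundary.

A variance that is at least `κ` at the start rules out the second case: the weight of player `0`
then decays geometrically, and since each round displaces the opponent's log-odds by at most a
constant times that weight, the total displacement is at most `1` and the variance stays above
`κ / e`.

The symmetry `(z₁, z₂, z₃, z₄) ↦ (1 - z₃, 1 - z₄, z₁, z₂)` of order four commutes with the
dynamics and permutes the four faces, so it suffices to study one of them.
-/

namespace PeriodicOMWU

/-! ### Reweighting the odds of a probability -/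

/-- The normalizing factor of `tilt p d`. -/
noncomputable def tiltNorm (p d : ℝ) : ℝ := p * Real.exp d + (1 - p)

/-- The probability obtained from `p` by multiplying the odds `p / (1 - p)` by `exp d`.  In this
form one step of multiplicative weights with two strategies is an additive action of `d`. -/
noncomputable def tilt (p d : ℝ) : ℝ := p * Real.exp d / tiltNorm p d

@[simp] theorem tilt_zero_left (d : ℝ) : tilt 0 d = 0 := by simp [tilt]

@[simp] theorem tilt_zero_right (p : ℝ) : tilt p 0 = p := by simp [tilt, tiltNorm]

theorem mul_exp_div_eq_tilt (p u v : ℝ) :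
    p * Real.exp u / (p * Real.exp u + (1 - p) * Real.exp v) = tilt p (u - v) := by
  have hu : Real.exp u = Real.exp (u - v) * Real.exp v := by rw [← Real.exp_add, sub_add_cancel]
  rw [tilt, tiltNorm, hu, ← mul_assoc, ← add_mul, mul_div_mul_right _ _ (Real.exp_pos v).ne']

section UnitInterval

variable {p : ℝ}

theorem mul_one_sub_nonneg (hp : p ∈ Set.Icc (0 : ℝ) 1) : 0 ≤ p * (1 - p) :=
  mul_nonneg hp.1 (sub_nonneg.2 hp.2)

theorem tiltNorm_pos (hp : p ∈ Set.Icc (0 : ℝ) 1) (d : ℝ) : 0 < tiltNorm p d := by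
  have hd := Real.exp_pos d
  unfold tiltNorm
  rcases hp.1.eq_or_lt with rfl | h
  · simp
  · linarith [mul_pos h hd, hp.2]

theorem one_sub_tilt (hp : p ∈ Set.Icc (0 : ℝ) 1) (d : ℝ) :
    1 - tilt p d = (1 - p) / tiltNorm p d := by
  rw [tilt, one_sub_div (tiltNorm_pos hp d).ne', tiltNorm, add_sub_cancel_left]

theorem tilt_mem_Icc (hp : p ∈ Set.Icc (0 : ℝ) 1) (d : ℝ) : tilt p d ∈ Set.Icc (0 : ℝ) 1 := by
  have hN := tiltNorm_pos hp d
  refine ⟨div_nonneg (mul_nonneg hp.1 (Real.exp_pos d).le) hN.le, sub_nonneg.1 ?_⟩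
  rw [one_sub_tilt hp]
  exact div_nonneg (sub_nonneg.2 hp.2) hN.le

theorem tilt_mem_Ioo (hp : p ∈ Set.Ioo (0 : ℝ) 1) (d : ℝ) : tilt p d ∈ Set.Ioo (0 : ℝ) 1 := by
  have hp' := Set.Ioo_subset_Icc_self hp
  have hN := tiltNorm_pos hp' d
  refine ⟨div_pos (mul_pos hp.1 (Real.exp_pos d)) hN, sub_pos.1 ?_⟩
  rw [one_sub_tilt hp']
  exact div_pos (sub_pos.2 hp.2) hN

theorem tilt_one_sub (hp : p ∈ Set.Icc (0 : ℝ) 1) (d : ℝ) :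
    tilt (1 - p) (-d) = 1 - tilt p d := by
  have hd : Real.exp (-d) * Real.exp d = 1 := by rw [← Real.exp_add, neg_add_cancel, Real.exp_zero]
  have hN : tiltNorm (1 - p) (-d) * Real.exp d = tiltNorm p d := by
    unfold tiltNorm
    linear_combination (1 - p) * hd
  rw [one_sub_tilt hp, tilt, ← mul_div_mul_right _ _ (Real.exp_pos d).ne', hN, mul_assoc, hd,
    mul_one]

theorem tiltNorm_tilt (hp : p ∈ Set.Icc (0 : ℝ) 1) (d e : ℝ) :
    tiltNorm (tilt p d) e = tiltNorm p (d + e) / tiltNorm p d := by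
  rw [tiltNorm, one_sub_tilt hp, tilt, div_mul_eq_mul_div, ← add_div, mul_assoc, ← Real.exp_add]
  rfl

theorem tilt_tilt (hp : p ∈ Set.Icc (0 : ℝ) 1) (d e : ℝ) :
    tilt (tilt p d) e = tilt p (d + e) := by
  rw [tilt, tiltNorm_tilt hp, tilt, div_mul_eq_mul_div, mul_assoc, ← Real.exp_add,
    div_div_div_cancel_right₀ (tiltNorm_pos hp d).ne', tilt]

theorem tilt_sub_self (hp : p ∈ Set.Icc (0 : ℝ) 1) (d : ℝ) :
    tilt p d - p = p * (1 - p) * ((Real.exp d - 1) / tiltNorm p d) := by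
  have hN := tiltNorm_pos hp d
  rw [tilt]
  field_simp
  rw [tiltNorm]
  ring

theorem tiltNorm_le_exp_abs (hp : p ∈ Set.Icc (0 : ℝ) 1) (d : ℝ) :
    tiltNorm p d ≤ Real.exp |d| := by
  have h₁ : Real.exp d ≤ Real.exp |d| := Real.exp_le_exp.2 (le_abs_self d)
  have h₂ : 1 ≤ Real.exp |d| := Real.one_le_exp (abs_nonneg d)
  unfold tiltNorm
  nlinarith [hp.1, hp.2]

theorem mul_one_sub_exp_neg_le_tilt_sub_self (hp : p ∈ Set.Icc (0 : ℝ) 1) {d : ℝ} (hd : 0 ≤ d) :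
    p * (1 - p) * (1 - Real.exp (-d)) ≤ tilt p d - p := by
  rw [tilt_sub_self hp]
  refine mul_le_mul_of_nonneg_left ?_ (mul_one_sub_nonneg hp)
  have hN := tiltNorm_le_exp_abs hp d
  rw [abs_of_nonneg hd] at hN
  calc 1 - Real.exp (-d) = (Real.exp d - 1) / Real.exp d := by
        rw [sub_div, div_self (Real.exp_pos d).ne', Real.exp_neg, one_div]
    _ ≤ (Real.exp d - 1) / tiltNorm p d :=
        div_le_div_of_nonneg_left (sub_nonneg.2 (Real.one_le_exp hd)) (tiltNorm_pos hp d) hN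

theorem tilt_monotone (hp : p ∈ Set.Icc (0 : ℝ) 1) : Monotone (tilt p) := by
  intro d e hde
  have hpd := tilt_mem_Icc hp d
  have hgain := mul_one_sub_exp_neg_le_tilt_sub_self hpd (sub_nonneg.2 hde)
  rw [tilt_tilt hp, add_sub_cancel] at hgain
  have hexp : Real.exp (-(e - d)) ≤ 1 := Real.exp_le_one_iff.2 (by linarith)
  linarith [mul_nonneg (mul_one_sub_nonneg hpd) (sub_nonneg.2 hexp)]

theorem tilt_sub_self_le (hp : p ∈ Set.Icc (0 : ℝ) 1) {d : ℝ} (hd : 0 ≤ d) :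
    tilt p d - p ≤ p * (1 - p) * (Real.exp d - 1) := by
  rw [tilt_sub_self hp]
  have hexp := Real.one_le_exp hd
  have hN : 1 ≤ tiltNorm p d := by unfold tiltNorm; nlinarith [hp.1]
  exact mul_le_mul_of_nonneg_left (div_le_self (sub_nonneg.2 hexp) hN) (mul_one_sub_nonneg hp)

theorem abs_tilt_sub_self_le (hp : p ∈ Set.Icc (0 : ℝ) 1) (d : ℝ) :
    |tilt p d - p| ≤ p * (1 - p) * (Real.exp |d| - 1) := by
  rcases le_total 0 d with hd | hd
  · rw [abs_of_nonneg hd, abs_of_nonneg]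
    · exact tilt_sub_self_le hp hd
    · simpa using tilt_monotone hp hd
  · -- exchanging `p` with `1 - p` and `d` with `-d` reduces to the first case
    have hp' : 1 - p ∈ Set.Icc (0 : ℝ) 1 := Set.Icc.mem_iff_one_sub_mem.1 hp
    have hle := tilt_sub_self_le hp' (neg_nonneg.2 hd)
    rw [tilt_one_sub hp] at hle
    rw [abs_of_nonpos hd, abs_of_nonpos]
    · linarith
    · simpa using tilt_monotone hp hd

theorem mul_exp_neg_abs_le_tilt_mul_one_sub (hp : p ∈ Set.Icc (0 : ℝ) 1) (d : ℝ) :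
    p * (1 - p) * Real.exp (-|d|) ≤ tilt p d * (1 - tilt p d) := by
  have hN := tiltNorm_pos hp d
  have hvar : tilt p d * (1 - tilt p d) =
      p * (1 - p) * (Real.exp d / tiltNorm p d ^ 2) := by
    rw [one_sub_tilt hp, tilt]
    ring
  rw [hvar]
  refine mul_le_mul_of_nonneg_left ?_ (mul_one_sub_nonneg hp)
  rw [le_div_iff₀ (by positivity)]
  have hNle : tiltNorm p d ≤ Real.exp ((d + |d|) / 2) := by
    rcases le_total 0 d with hd | hd
    · simpa only [abs_of_nonneg hd, add_self_div_two] using tiltNorm_le_exp_abs hp d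
    · rw [abs_of_nonpos hd, add_neg_cancel, zero_div, Real.exp_zero, tiltNorm]
      nlinarith [hp.1, Real.exp_le_one_iff.2 hd]
  calc Real.exp (-|d|) * tiltNorm p d ^ 2 ≤ Real.exp (-|d|) * Real.exp ((d + |d|) / 2) ^ 2 := by
        gcongr
    _ = Real.exp d := by
        rw [← Real.exp_nat_mul, ← Real.exp_add]
        push_cast
        ring_nf

theorem tilt_mul_one_sub_le (hp : p ∈ Set.Icc (0 : ℝ) 1) (d : ℝ) :
    tilt p d * (1 - tilt p d) ≤ p * (1 - p) * Real.exp |d| := by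
  have hinv := mul_exp_neg_abs_le_tilt_mul_one_sub (tilt_mem_Icc hp d) (-d)
  rwa [tilt_tilt hp, add_neg_cancel, tilt_zero_right, abs_neg, Real.exp_neg, ← div_eq_mul_inv,
    div_le_iff₀ (Real.exp_pos _)] at hinv

theorem tilt_le_mul_exp_abs (hp : p ∈ Set.Icc (0 : ℝ) 1) (d : ℝ) :
    tilt p d ≤ p * Real.exp |d| := by
  refine (tilt_monotone hp (le_abs_self d)).trans ?_
  have hN : 1 ≤ tiltNorm p |d| := by
    unfold tiltNorm
    nlinarith [hp.1, Real.one_le_exp (abs_nonneg d)]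
  exact div_le_self (mul_nonneg hp.1 (Real.exp_pos _).le) hN

theorem tilt_le_two_mul_exp (h₀ : 0 ≤ p) (h₁ : p ≤ 1 / 2) (d : ℝ) :
    tilt p d ≤ 2 * p * Real.exp d := by
  have hp : p ∈ Set.Icc (0 : ℝ) 1 := ⟨h₀, by linarith⟩
  have hexp := mul_nonneg h₀ (Real.exp_pos d).le
  rw [tilt, div_le_iff₀ (tiltNorm_pos hp d), tiltNorm]
  nlinarith

end UnitInterval

/-! ### The maps in terms of `tilt` -/

theorem G₁_eq (η : ℝ) (z : Fin 4 → ℝ) :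
    G₁ η z = ![z 1, tilt (z 1) (3 * η - 4 * η * z 3 - 2 * η * z 2),
      z 3, tilt (z 3) (-(3 * η) + 4 * η * z 1 + 2 * η * z 0)] := by
  simp only [G₁, mul_exp_div_eq_tilt]
  ring_nf

theorem G₂_eq_G₁_neg (η : ℝ) : G₂ η = G₁ (-η) := by
  funext z
  simp only [G₂, G₁_eq, mul_exp_div_eq_tilt]
  ring_nf

theorem shift_eq_tilt (η a : ℝ) : shift η a = tilt a (-(3 * η)) := by
  rw [shift, neg_mul, tilt, tiltNorm]

theorem G₁_coord_zero (η : ℝ) (z : Fin 4 → ℝ) (j : Fin 2) :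
    G₁ η z (coord j 0) = z (coord j 1) := by
  fin_cases j <;> rfl

/-- The closed unit cube, which contains all iterate vectors. -/
def cube : Set (Fin 4 → ℝ) := {z | ∀ k, z k ∈ Set.Icc (0 : ℝ) 1}

theorem cube_eq_univ_pi : cube = Set.univ.pi fun _ => Set.Icc (0 : ℝ) 1 := by
  ext z
  simp only [cube, Set.mem_ofPred_eq, Set.mem_univ_pi]

theorem isCompact_cube : IsCompact cube := by
  rw [cube_eq_univ_pi]
  exact isCompact_univ_pi fun _ => isCompact_Icc

theorem uniqueDiffOn_cube : UniqueDiffOn ℝ cube := by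
  rw [cube_eq_univ_pi]
  exact UniqueDiffOn.univ_pi fun _ => uniqueDiffOn_Icc zero_lt_one

/-- Two steps of the dynamics, from an even time. -/
noncomputable abbrev twoStep (η : ℝ) : (Fin 4 → ℝ) → Fin 4 → ℝ := G₁ η ∘ G₂ η

theorem twoStep_apply (η : ℝ) (z : Fin 4 → ℝ) : twoStep η z = G₁ η (G₁ (-η) z) := by
  rw [twoStep, Function.comp_apply, G₂_eq_G₁_neg]

theorem twoStep_apply_zero (η : ℝ) (z : Fin 4 → ℝ) :
    twoStep η z 0 = tilt (z 1) (-(3 * η) + 4 * η * z 3 + 2 * η * z 2) := by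
  rw [twoStep_apply, G₁_eq, G₁_eq]
  simp only [Matrix.cons_val]
  ring_nf

theorem twoStep_apply_two (η : ℝ) (z : Fin 4 → ℝ) :
    twoStep η z 2 = tilt (z 3) (3 * η - 4 * η * z 1 - 2 * η * z 0) := by
  rw [twoStep_apply, G₁_eq, G₁_eq]
  simp only [Matrix.cons_val]
  ring_nf

section Cube

variable {z : Fin 4 → ℝ}

theorem G₁_mem_cube (η : ℝ) (hz : z ∈ cube) : G₁ η z ∈ cube := by
  rw [G₁_eq]
  intro k
  fin_cases k
  exacts [hz 1, tilt_mem_Icc (hz 1) _, hz 3, tilt_mem_Icc (hz 3) _]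

theorem exists_G₁_eq_tilt (η : ℝ) (hz : z ∈ cube) (j : Fin 2) :
    ∃ d, |d| ≤ 3 * |η| ∧ G₁ η z (coord j 1) = tilt (z (coord j 1)) d := by
  have hbound : ∀ u : ℝ, |u| ≤ 3 → |η * u| ≤ 3 * |η| := fun u hu => by
    rw [abs_mul, mul_comm]
    exact mul_le_mul_of_nonneg_right hu (abs_nonneg η)
  obtain ⟨⟨h₀, h₀'⟩, h₁, h₁'⟩ := And.intro (hz 0) (hz 1)
  obtain ⟨⟨h₂, h₂'⟩, h₃, h₃'⟩ := And.intro (hz 2) (hz 3)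
  rw [G₁_eq]
  fin_cases j
  · refine ⟨_, hbound (3 - 4 * z 3 - 2 * z 2) (abs_le.2 ⟨by linarith, by linarith⟩), ?_⟩
    change tilt (z 1) _ = tilt (z 1) _
    ring_nf
  · refine ⟨_, hbound (-3 + 4 * z 1 + 2 * z 0) (abs_le.2 ⟨by linarith, by linarith⟩), ?_⟩
    change tilt (z 3) _ = tilt (z 3) _
    ring_nf

theorem twoStep_mem_cube (η : ℝ) (hz : z ∈ cube) : twoStep η z ∈ cube := by
  rw [twoStep_apply]
  exact G₁_mem_cube η (G₁_mem_cube (-η) hz)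

theorem exists_twoStep_eq_tilt (η : ℝ) (hz : z ∈ cube) (j : Fin 2) :
    ∃ d, |d| ≤ 6 * |η| ∧ twoStep η z (coord j 1) = tilt (z (coord j 1)) d := by
  obtain ⟨d, hd, hzd⟩ := exists_G₁_eq_tilt (-η) hz j
  obtain ⟨e, he, hze⟩ := exists_G₁_eq_tilt η (G₁_mem_cube (-η) hz) j
  rw [abs_neg] at hd
  refine ⟨d + e, (abs_add_le d e).trans (by linarith), ?_⟩
  rw [twoStep_apply, hze, hzd, tilt_tilt (hz _)]

theorem twoStep_apply_one (η : ℝ) (hz : z ∈ cube) :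
    twoStep η z 1 = tilt (z 1) (2 * η * (z 3 + z 2 - 2 * twoStep η z 2)) := by
  rw [twoStep_apply, G₁_eq η, G₁_eq (-η)]
  simp only [Matrix.cons_val]
  rw [tilt_tilt (hz 1)]
  ring_nf

theorem twoStep_apply_three (η : ℝ) (hz : z ∈ cube) :
    twoStep η z 3 = tilt (z 3) (2 * η * (2 * twoStep η z 0 - z 1 - z 0)) := by
  rw [twoStep_apply, G₁_eq η, G₁_eq (-η)]
  simp only [Matrix.cons_val]
  rw [tilt_tilt (hz 3)]
  ring_nf

theorem G₁_one_le (η : ℝ) (hz : z ∈ cube) : G₁ η z 1 ≤ z 1 * Real.exp (3 * |η|) := by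
  obtain ⟨d, hd, hstep⟩ := exists_G₁_eq_tilt η hz 0
  exact hstep.trans_le <| (tilt_le_mul_exp_abs (hz 1) d).trans <|
    mul_le_mul_of_nonneg_left (Real.exp_le_exp.2 hd) (hz 1).1

theorem twoStep_one_le_of_lt {η δ : ℝ} (hz : z ∈ cube) (hδ : z 1 < δ * Real.exp (-(6 * |η|))) :
    twoStep η z 1 ≤ δ := by
  obtain ⟨d, hd, hstep⟩ := exists_twoStep_eq_tilt η hz 0
  rw [Real.exp_neg, ← div_eq_mul_inv, lt_div_iff₀ (Real.exp_pos _)] at hδ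
  exact hstep.trans_le <| (tilt_le_mul_exp_abs (hz 1) d).trans <|
    (mul_le_mul_of_nonneg_left (Real.exp_le_exp.2 hd) (hz 1).1).trans hδ.le

theorem lt_of_twoStep_one_lt {η δ : ℝ} (hz : z ∈ cube)
    (hδ : twoStep η z 1 < δ * Real.exp (-(6 * |η|))) : z 1 < δ := by
  obtain ⟨d, hd, hstep⟩ := exists_twoStep_eq_tilt η hz 0
  change twoStep η z 1 = tilt (z 1) d at hstep
  rw [Real.exp_neg, ← div_eq_mul_inv, lt_div_iff₀ (Real.exp_pos _), hstep] at hδ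
  refine lt_of_le_of_lt ?_ hδ
  have hback := tilt_le_mul_exp_abs (tilt_mem_Icc (hz 1) d) (-d)
  rw [tilt_tilt (hz 1), add_neg_cancel, tilt_zero_right, abs_neg] at hback
  exact hback.trans <|
    mul_le_mul_of_nonneg_left (Real.exp_le_exp.2 hd) (tilt_mem_Icc (hz 1) d).1

theorem iterate_twoStep_mem_cube (η : ℝ) (hz : z ∈ cube) (m : ℕ) : (twoStep η)^[m] z ∈ cube :=
  Set.MapsTo.iterate (fun _ => twoStep_mem_cube η) m hz

/-- The variance of the current strategy of the opponent (player `1`).  It is the rate at which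
player `0` drifts to the face `{z | z 1 = 0}` where player `0` does not use strategy `0`. -/
def oppVar (z : Fin 4 → ℝ) : ℝ := z 3 * (1 - z 3)

theorem oppVar_nonneg (hz : z ∈ cube) : 0 ≤ oppVar z :=
  mul_one_sub_nonneg (hz 3)

theorem oppVar_mul_exp_le_oppVar_G₁ (η : ℝ) (hz : z ∈ cube) :
    oppVar z * Real.exp (-(3 * |η|)) ≤ oppVar (G₁ η z) := by
  obtain ⟨d, hd, hstep⟩ := exists_G₁_eq_tilt η hz 1
  change G₁ η z 3 = tilt (z 3) d at hstep
  rw [oppVar, oppVar, hstep]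
  refine le_trans ?_ (mul_exp_neg_abs_le_tilt_mul_one_sub (hz 3) d)
  exact mul_le_mul_of_nonneg_left (Real.exp_le_exp.2 (neg_le_neg hd)) (oppVar_nonneg hz)

theorem oppVar_mul_exp_le_oppVar_twoStep (η : ℝ) (hz : z ∈ cube) :
    oppVar z * Real.exp (-(6 * |η|)) ≤ oppVar (twoStep η z) := by
  obtain ⟨d, hd, hstep⟩ := exists_twoStep_eq_tilt η hz 1
  change twoStep η z 3 = tilt (z 3) d at hstep
  rw [oppVar, oppVar, hstep]
  refine le_trans ?_ (mul_exp_neg_abs_le_tilt_mul_one_sub (hz 3) d)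
  exact mul_le_mul_of_nonneg_left (Real.exp_le_exp.2 (neg_le_neg hd)) (oppVar_nonneg hz)

end Cube

/-! ### The family of fixed points on the face where player `0` does not use strategy `0` -/

/-- The point `(0, 0, a, φ(a))` of the first family of fixed points. -/
noncomputable def basePoint (η a : ℝ) : Fin 4 → ℝ := ![0, 0, a, shift η a]

theorem basePoint_mem_cube (η : ℝ) {a : ℝ} (ha : a ∈ Set.Icc (0 : ℝ) 1) :
    basePoint η a ∈ cube := by
  have h₀ : (0 : ℝ) ∈ Set.Icc (0 : ℝ) 1 := Set.left_mem_Icc.2 zero_le_one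
  have hshift : shift η a ∈ Set.Icc (0 : ℝ) 1 := shift_eq_tilt η a ▸ tilt_mem_Icc ha _
  intro k
  fin_cases k
  exacts [h₀, h₀, ha, hshift]

theorem twoStep_eq_basePoint (η : ℝ) {z : Fin 4 → ℝ} (hz : z ∈ cube) (hz₁ : z 1 = 0) :
    twoStep η z = basePoint η (tilt (z 3) (3 * η - 2 * η * z 0)) := by
  have h₀ : twoStep η z 0 = 0 := by rw [twoStep_apply_zero, hz₁, tilt_zero_left]
  funext k
  fin_cases k
  · exact h₀
  · exact (twoStep_apply_one η hz).trans (by rw [hz₁, tilt_zero_left]; rfl)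
  · exact (twoStep_apply_two η z).trans (by rw [hz₁, mul_zero, sub_zero]; rfl)
  · refine (twoStep_apply_three η hz).trans ?_
    rw [h₀, hz₁]
    change _ = shift η _
    rw [shift_eq_tilt, tilt_tilt (hz 3)]
    ring_nf

theorem isFixedPt_basePoint (η : ℝ) {a : ℝ} (ha : a ∈ Set.Icc (0 : ℝ) 1) :
    Function.IsFixedPt (twoStep η) (basePoint η a) := by
  rw [Function.IsFixedPt, twoStep_eq_basePoint η (basePoint_mem_cube η ha) rfl]
  change basePoint η (tilt (shift η a) (3 * η - 2 * η * 0)) = basePoint η a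
  rw [shift_eq_tilt, tilt_tilt ha, mul_zero, sub_zero, neg_add_cancel, tilt_zero_right]

/-! ### The Jacobian -/

/-- The partial derivative of `tilt p d` in `p`. -/
noncomputable def tiltDeriv (p d : ℝ) : ℝ := Real.exp d / tiltNorm p d ^ 2

@[simp] theorem tiltDeriv_zero_left (d : ℝ) : tiltDeriv 0 d = Real.exp d := by
  simp [tiltDeriv, tiltNorm]

@[simp] theorem tiltDeriv_zero_right (p : ℝ) : tiltDeriv p 0 = 1 := by simp [tiltDeriv, tiltNorm]

theorem tiltDeriv_tilt_mul {p : ℝ} (hp : p ∈ Set.Icc (0 : ℝ) 1) (d e : ℝ) :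
    tiltDeriv (tilt p d) e * tiltDeriv p d = tiltDeriv p (d + e) := by
  have hd := (tiltNorm_pos hp d).ne'
  have hde := (tiltNorm_pos hp (d + e)).ne'
  rw [tiltDeriv, tiltNorm_tilt hp, tiltDeriv, tiltDeriv, Real.exp_add]
  field_simp

theorem hasFDerivAt_tilt {E : Type*} [NormedAddCommGroup E] [NormedSpace ℝ E] {f g : E → ℝ}
    {f' g' : E →L[ℝ] ℝ} {x : E} (hf : HasFDerivAt f f' x) (hg : HasFDerivAt g g' x)
    (hx : f x ∈ Set.Icc (0 : ℝ) 1) :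
    HasFDerivAt (fun y => tilt (f y) (g y))
      (tiltDeriv (f x) (g x) • f' + (tilt (f x) (g x) * (1 - tilt (f x) (g x))) • g') x := by
  have hN := tiltNorm_pos hx (g x)
  have hnum := hf.fun_mul hg.exp
  have hden : HasFDerivAt (fun y => tiltNorm (f y) (g y)) _ x := hnum.fun_add (hf.const_sub 1)
  have hinv := (hasDerivAt_inv hN.ne').comp_hasFDerivAt x hden
  refine ((hnum.fun_mul hinv).congr_of_eventuallyEq (.of_forall fun y => ?_)).congr_fderiv ?_
  · exact div_eq_mul_inv _ _
  · ext v
    rw [one_sub_tilt hx, tilt, tiltDeriv]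
    simp only [Function.comp_apply, add_apply, smul_apply, neg_apply, smul_eq_mul]
    field_simp
    rw [tiltNorm]
    ring

theorem hasFDerivAt_G₁ (η : ℝ) {z : Fin 4 → ℝ} (hz : z ∈ cube) :
    HasFDerivAt (G₁ η) (Matrix.toLin' (
      let d₀ := 3 * η - 4 * η * z 3 - 2 * η * z 2
      let d₁ := -(3 * η) + 4 * η * z 1 + 2 * η * z 0
      let v₀ := tilt (z 1) d₀ * (1 - tilt (z 1) d₀)
      let v₁ := tilt (z 3) d₁ * (1 - tilt (z 3) d₁)
      !![0, 1, 0, 0;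
        0, tiltDeriv (z 1) d₀, -2 * η * v₀, -4 * η * v₀;
        0, 0, 0, 1;
        2 * η * v₁, 4 * η * v₁, 0, tiltDeriv (z 3) d₁])).toContinuousLinearMap z := by
  have hcoord : ∀ k : Fin 4, HasFDerivAt (fun y : Fin 4 → ℝ => y k)
    (ContinuousLinearMap.proj (R := ℝ) (φ := fun _ => ℝ) k) z := fun k => hasFDerivAt_apply k z
  have h₀ := hasFDerivAt_tilt (hcoord 1)
    ((((hcoord 3).const_mul (4 * η)).const_sub (3 * η)).fun_sub ((hcoord 2).const_mul (2 * η)))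
    (hz 1)
  have h₁ := hasFDerivAt_tilt (hcoord 3)
    ((((hcoord 1).const_mul (4 * η)).const_add (-(3 * η))).fun_add ((hcoord 0).const_mul (2 * η)))
    (hz 3)
  rw [funext (G₁_eq η)]
  refine hasFDerivAt_pi'.2 fun k => ?_
  fin_cases k
  · refine (hcoord 1).congr_fderiv ?_
    ext v
    simp [Matrix.vecHead, Matrix.vecTail]
  · refine h₀.congr_fderiv ?_
    ext v
    simp only [add_apply, sub_apply, neg_apply, smul_apply, ContinuousLinearMap.proj_apply,
      ContinuousLinearMap.comp_apply, LinearMap.coe_toContinuousLinearMap', Matrix.toLin'_apply,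
      Matrix.cons_mulVec, Matrix.cons_dotProduct, Matrix.dotProduct_of_isEmpty, Matrix.vecHead,
      Matrix.vecTail, Function.comp_apply, Matrix.cons_val_zero, Matrix.cons_val_one, Fin.mk_one,
      Fin.reduceSucc]
    ring
  · refine (hcoord 3).congr_fderiv ?_
    ext v
    simp [Matrix.vecHead, Matrix.vecTail]
  · refine h₁.congr_fderiv ?_
    ext v
    simp only [add_apply, smul_apply, ContinuousLinearMap.proj_apply,
      ContinuousLinearMap.comp_apply, LinearMap.coe_toContinuousLinearMap', Matrix.toLin'_apply,
      Matrix.cons_mulVec, Matrix.cons_dotProduct, Matrix.dotProduct_of_isEmpty, Matrix.vecHead,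
      Matrix.vecTail, Function.comp_apply, Matrix.cons_val, Fin.reduceFinMk, Fin.reduceSucc]
    ring

theorem differentiableAt_G₁ (η : ℝ) {z : Fin 4 → ℝ} (hz : z ∈ cube) :
    DifferentiableAt ℝ (G₁ η) z :=
  (hasFDerivAt_G₁ η hz).differentiableAt

theorem differentiableAt_twoStep (η : ℝ) {z : Fin 4 → ℝ} (hz : z ∈ cube) :
    DifferentiableAt ℝ (twoStep η) z := by
  rw [twoStep, G₂_eq_G₁_neg]
  exact (differentiableAt_G₁ η (G₁_mem_cube (-η) hz)).comp z (differentiableAt_G₁ (-η) hz)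

theorem continuousOn_twoStep (η : ℝ) : ContinuousOn (twoStep η) cube :=
  fun _ hz => (differentiableAt_twoStep η hz).continuousAt.continuousWithinAt

theorem jacobian_comp {f g : (Fin 4 → ℝ) → Fin 4 → ℝ} {z : Fin 4 → ℝ}
    (hf : DifferentiableAt ℝ f (g z)) (hg : DifferentiableAt ℝ g z) :
    jacobian (f ∘ g) z = jacobian f (g z) * jacobian g z := by
  rw [jacobian, fderiv_comp z hf hg, ContinuousLinearMap.toLinearMap_comp, LinearMap.toMatrix'_comp,
    jacobian, jacobian]

theorem jacobian_G₁_of_one_eq_zero (η : ℝ) {z : Fin 4 → ℝ} (hz : z ∈ cube) (hz₁ : z 1 = 0) :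
    ∃ u v, jacobian (G₁ η) z =
      !![0, 1, 0, 0;
        0, Real.exp (3 * η - 4 * η * z 3 - 2 * η * z 2), 0, 0;
        0, 0, 0, 1;
        u, v, 0, tiltDeriv (z 3) (-(3 * η) + 2 * η * z 0)] := by
  rw [jacobian, (hasFDerivAt_G₁ η hz).fderiv, LinearMap.coe_toContinuousLinearMap,
    LinearMap.toMatrix'_toLin', hz₁]
  simp only [tilt_zero_left, tiltDeriv_zero_left, mul_zero, zero_mul, add_zero]
  exact ⟨_, _, rfl⟩

theorem charpoly_mul_face_matrices {R : Type*} [CommRing R] (l m u v l' m' u' v' : R) :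
    (!![0, 1, 0, 0; 0, l, 0, 0; 0, 0, 0, 1; u, v, 0, m] *
      !![0, 1, 0, 0; 0, l', 0, 0; 0, 0, 0, 1; u', v', 0, m']).charpoly =
        X ^ 2 * (X - C (m * m')) * (X - C (l * l')) := by
  have hmul : !![0, 1, 0, 0; 0, l, 0, 0; 0, 0, 0, 1; u, v, 0, m] *
      !![0, 1, 0, 0; 0, l', 0, 0; 0, 0, 0, 1; u', v', 0, m'] =
        !![0, l', 0, 0;
          0, l * l', 0, 0;
          u', v', 0, m';
          m * u', u + v * l' + m * v', 0, m * m'] := by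
    ext i j
    fin_cases i <;> fin_cases j <;> simp [Matrix.mul_apply, Fin.sum_univ_four]
  rw [hmul, Matrix.charpoly, Matrix.det_succ_row_zero]
  simp only [Matrix.charmatrix_apply, Matrix.det_fin_three, Matrix.submatrix_apply,
    Matrix.diagonal_apply_eq, Matrix.diagonal_apply_ne, Matrix.of_apply, Matrix.cons_val,
    Fin.sum_univ_succ, Fin.succAbove, Fin.reduceSucc, Fin.reduceCastSucc, Fin.reduceLT,
    Fin.reduceEq, Fin.coe_ofNat_eq_mod, ne_eq, not_false_eq_true, ↓reduceIte, map_zero]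
  ring

theorem fourthEigenvalue_eq (η : ℝ) {a : ℝ} (ha : a ∈ Set.Icc (0 : ℝ) 1) :
    fourthEigenvalue η a = Real.exp (2 * η * (shift η a - a)) := by
  have hN := (tiltNorm_pos ha (-(3 * η))).ne'
  have hexp : Real.exp (3 * η) * Real.exp (-(3 * η)) = 1 := by rw [← Real.exp_add]; simp
  have hden : a + (1 - a) * Real.exp (3 * η) = Real.exp (3 * η) * tiltNorm a (-(3 * η)) := by
    rw [tiltNorm]
    linear_combination (-a) * hexp
  have hnum : Real.exp (-(3 * η)) - 1 = -(Real.exp (3 * η) - 1) / Real.exp (3 * η) := by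
    rw [eq_div_iff (Real.exp_pos _).ne']
    linear_combination hexp
  rw [fourthEigenvalue, shift_eq_tilt, tilt_sub_self ha, hden, hnum]
  congr 1
  field_simp [hN]

theorem fourthEigenvalue_lt_one {η : ℝ} (hη : 0 < η) {a : ℝ} (ha : a ∈ Set.Ioo (0 : ℝ) 1) :
    fourthEigenvalue η a < 1 := by
  have ha₀ : 0 < a := ha.1
  have ha₁ : 0 < 1 - a := sub_pos.2 ha.2
  have hexp : 0 < Real.exp (3 * η) - 1 := sub_pos.2 (Real.one_lt_exp_iff.2 (by linarith))
  rw [fourthEigenvalue, Real.exp_lt_one_iff, neg_lt_zero]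
  positivity

theorem charpoly_jacobian_basePoint (η : ℝ) {a : ℝ} (ha : a ∈ Set.Icc (0 : ℝ) 1) :
    (jacobian (twoStep η) (basePoint η a)).charpoly =
      X ^ 2 * (X - 1) * (X - C (fourthEigenvalue η a)) := by
  have hz := basePoint_mem_cube η ha
  have hw := G₁_mem_cube (-η) hz
  have hw_eq : G₁ (-η) (basePoint η a) = ![0, 0, shift η a, a] := by
    rw [G₁_eq]
    simp only [basePoint, Matrix.cons_val, tilt_zero_left, mul_zero, add_zero]
    rw [shift_eq_tilt, tilt_tilt ha, mul_neg, neg_neg, neg_add_cancel, tilt_zero_right]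
  obtain ⟨u, v, huv⟩ := jacobian_G₁_of_one_eq_zero (-η) hz rfl
  obtain ⟨u', v', huv'⟩ := jacobian_G₁_of_one_eq_zero η hw (by rw [hw_eq]; rfl)
  rw [twoStep, G₂_eq_G₁_neg, jacobian_comp (differentiableAt_G₁ η hw) (differentiableAt_G₁ (-η) hz),
    huv, huv', charpoly_mul_face_matrices, hw_eq, ← Real.exp_add, fourthEigenvalue_eq η ha]
  simp only [basePoint, Matrix.cons_val, mul_zero, add_zero]
  rw [shift_eq_tilt, mul_comm (tiltDeriv _ _), mul_neg, neg_neg, tiltDeriv_tilt_mul ha,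
    neg_add_cancel, tiltDeriv_zero_right, C_1]
  ring_nf

/-! ### The order-four symmetry -/

/-- The inverse of the symmetry `(z₁, z₂, z₃, z₄) ↦ (1 - z₃, 1 - z₄, z₁, z₂)` of the dynamics: it
exchanges the players and, for one of them, the strategies. -/
def turn (z : Fin 4 → ℝ) : Fin 4 → ℝ := ![z 2, z 3, 1 - z 0, 1 - z 1]

/-- The power of `turn` that carries the face where player `i` does not use strategy `s` to the
face `{z | z 0 = 0 ∧ z 1 = 0}`. -/
def toFace (i s : Fin 2) : (Fin 4 → ℝ) → Fin 4 → ℝ := turn^[i + 2 * s]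

theorem turn_mem_cube {z : Fin 4 → ℝ} (hz : z ∈ cube) : turn z ∈ cube := by
  intro k
  fin_cases k
  exacts [hz 2, hz 3, Set.Icc.mem_iff_one_sub_mem.1 (hz 0), Set.Icc.mem_iff_one_sub_mem.1 (hz 1)]

theorem isometry_turn : Isometry turn := by
  refine Isometry.of_dist_eq fun z w => le_antisymm ?_ ?_
  · refine (dist_pi_le_iff dist_nonneg).2 fun k => ?_
    fin_cases k
    · exact dist_le_pi_dist z w 2
    · exact dist_le_pi_dist z w 3
    · exact (dist_sub_left 1 (z 0) (w 0)).trans_le (dist_le_pi_dist z w 0)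
    · exact (dist_sub_left 1 (z 1) (w 1)).trans_le (dist_le_pi_dist z w 1)
  · refine (dist_pi_le_iff dist_nonneg).2 fun k => ?_
    fin_cases k
    · exact (dist_sub_left 1 (z 0) (w 0)).symm.trans_le (dist_le_pi_dist (turn z) (turn w) 2)
    · exact (dist_sub_left 1 (z 1) (w 1)).symm.trans_le (dist_le_pi_dist (turn z) (turn w) 3)
    · exact dist_le_pi_dist (turn z) (turn w) 0
    · exact dist_le_pi_dist (turn z) (turn w) 1

theorem G₁_turn (η : ℝ) {z : Fin 4 → ℝ} (hz : z ∈ cube) : G₁ η (turn z) = turn (G₁ η z) := by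
  rw [G₁_eq, G₁_eq]
  simp only [turn, Matrix.cons_val]
  rw [← tilt_one_sub (hz 1)]
  ring_nf

theorem iterate_turn_mem_cube {z : Fin 4 → ℝ} (hz : z ∈ cube) (k : ℕ) : turn^[k] z ∈ cube :=
  Set.MapsTo.iterate (fun _ => turn_mem_cube) k hz

theorem toFace_mem_cube (i s : Fin 2) {z : Fin 4 → ℝ} (hz : z ∈ cube) : toFace i s z ∈ cube :=
  iterate_turn_mem_cube hz _

theorem isometry_toFace (i s : Fin 2) : Isometry (toFace i s) := by
  unfold toFace
  generalize (i + 2 * s : ℕ) = k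
  induction k with
  | zero => exact isometry_id
  | succ k ih =>
    rw [Function.iterate_succ']
    exact isometry_turn.comp ih

theorem G₁_toFace (η : ℝ) (i s : Fin 2) {z : Fin 4 → ℝ} (hz : z ∈ cube) :
    G₁ η (toFace i s z) = toFace i s (G₁ η z) := by
  unfold toFace
  generalize (i + 2 * s : ℕ) = k
  induction k with
  | zero => rfl
  | succ k ih =>
    rw [Function.iterate_succ_apply', G₁_turn η (iterate_turn_mem_cube hz k), ih,
      Function.iterate_succ_apply']

theorem twoStep_toFace (η : ℝ) (i s : Fin 2) {z : Fin 4 → ℝ} (hz : z ∈ cube) :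
    twoStep η (toFace i s z) = toFace i s (twoStep η z) := by
  rw [twoStep_apply, G₁_toFace (-η) i s hz, G₁_toFace η i s (G₁_mem_cube (-η) hz), twoStep_apply]

theorem iterate_twoStep_toFace (η : ℝ) (i s : Fin 2) {z : Fin 4 → ℝ} (hz : z ∈ cube) (m : ℕ) :
    (twoStep η)^[m] (toFace i s z) = toFace i s ((twoStep η)^[m] z) := by
  induction m with
  | zero => rfl
  | succ m ih =>
    rw [Function.iterate_succ_apply', ih, twoStep_toFace η i s (iterate_twoStep_mem_cube η hz m),
      Function.iterate_succ_apply']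

theorem toFace_coord (i s : Fin 2) (z : Fin 4 → ℝ) (j r : Fin 2) :
    toFace i s z (coord j r) = ![z (coord (i + j) r), 1 - z (coord (i + j) r)] (s + i * j) := by
  fin_cases i <;> fin_cases s <;> fin_cases j <;> fin_cases r <;> simp [toFace, turn, coord]

theorem toFace_facePoint (η : ℝ) (i s : Fin 2) (a : ℝ) :
    toFace i s (facePoint η i s a) = basePoint η a := by
  fin_cases i <;> fin_cases s <;> simp [toFace, turn, facePoint, basePoint]

theorem facePoint_mem_cube (η : ℝ) (i s : Fin 2) {a : ℝ} (ha : a ∈ Set.Icc (0 : ℝ) 1) :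
    facePoint η i s a ∈ cube := by
  have hinv : toFace i s (toFace i s (toFace i s (basePoint η a))) = facePoint η i s a := by
    fin_cases i <;> fin_cases s <;> simp [toFace, turn, facePoint, basePoint]
  rw [← hinv]
  exact toFace_mem_cube i s (toFace_mem_cube i s (toFace_mem_cube i s (basePoint_mem_cube η ha)))

theorem isFixedPt_facePoint (η : ℝ) (i s : Fin 2) {a : ℝ} (ha : a ∈ Set.Icc (0 : ℝ) 1) :
    Function.IsFixedPt (twoStep η) (facePoint η i s a) := by
  refine (isometry_toFace i s).injective ?_
  rw [← twoStep_toFace η i s (facePoint_mem_cube η i s ha), toFace_facePoint,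
    isFixedPt_basePoint η ha]

theorem jacobian_eq_of_eqOn {f g : (Fin 4 → ℝ) → Fin 4 → ℝ} {S : Set (Fin 4 → ℝ)}
    (hfg : Set.EqOn f g S) (hS : UniqueDiffOn ℝ S) {z : Fin 4 → ℝ} (hz : z ∈ S)
    (hf : DifferentiableAt ℝ f z) (hg : DifferentiableAt ℝ g z) : jacobian f z = jacobian g z := by
  have hu := hS z hz
  rw [jacobian, ← hf.fderivWithin hu, fderivWithin_congr hfg (hfg hz), hg.fderivWithin hu, jacobian]

/-- The linear part of the affine map `turn`. -/
def turnMatrix : Matrix (Fin 4) (Fin 4) ℝ :=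
  !![0, 0, 1, 0; 0, 0, 0, 1; -1, 0, 0, 0; 0, -1, 0, 0]

theorem turnMatrix_mul_transpose : turnMatrix * turnMatrix.transpose = 1 := by
  ext i j
  fin_cases i <;> fin_cases j <;> simp [turnMatrix, Matrix.mul_apply, Fin.sum_univ_four]

theorem hasFDerivAt_turn (z : Fin 4 → ℝ) :
    HasFDerivAt turn (Matrix.toLin' turnMatrix).toContinuousLinearMap z := by
  have hturn : turn =
      fun w => (Matrix.toLin' turnMatrix).toContinuousLinearMap w + ![0, 0, 1, 1] := by
    funext w k
    fin_cases k <;> simp [turn, turnMatrix, Matrix.vecHead, Matrix.vecTail, neg_add_eq_sub]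
  rw [hturn]
  exact (ContinuousLinearMap.hasFDerivAt _).add_const _

theorem differentiableAt_turn (z : Fin 4 → ℝ) : DifferentiableAt ℝ turn z :=
  (hasFDerivAt_turn z).differentiableAt

theorem jacobian_turn (z : Fin 4 → ℝ) : jacobian turn z = turnMatrix := by
  rw [jacobian, (hasFDerivAt_turn z).fderiv, LinearMap.coe_toContinuousLinearMap,
    LinearMap.toMatrix'_toLin']

theorem charpoly_jacobian_turn {f : (Fin 4 → ℝ) → Fin 4 → ℝ}
    (hf : ∀ z ∈ cube, DifferentiableAt ℝ f z) (hturn : ∀ z ∈ cube, f (turn z) = turn (f z))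
    {z : Fin 4 → ℝ} (hz : z ∈ cube) :
    (jacobian f (turn z)).charpoly = (jacobian f z).charpoly := by
  have hfz := hf z hz
  have hftz := hf (turn z) (turn_mem_cube hz)
  have hconj : jacobian f (turn z) * turnMatrix = turnMatrix * jacobian f z := by
    have heq := jacobian_eq_of_eqOn (f := f ∘ turn) (g := turn ∘ f) hturn uniqueDiffOn_cube hz
      (hftz.comp z (differentiableAt_turn z)) ((differentiableAt_turn _).comp z hfz)
    rwa [jacobian_comp hftz (differentiableAt_turn z), jacobian_comp (differentiableAt_turn _) hfz,
      jacobian_turn, jacobian_turn] at heq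
  rw [← mul_one (jacobian f (turn z)), ← turnMatrix_mul_transpose, ← mul_assoc, hconj,
    Matrix.charpoly_mul_comm, ← mul_assoc, mul_eq_one_comm.1 turnMatrix_mul_transpose, one_mul]

theorem charpoly_jacobian_toFace {f : (Fin 4 → ℝ) → Fin 4 → ℝ}
    (hf : ∀ z ∈ cube, DifferentiableAt ℝ f z) (hturn : ∀ z ∈ cube, f (turn z) = turn (f z))
    (i s : Fin 2) {z : Fin 4 → ℝ} (hz : z ∈ cube) :
    (jacobian f (toFace i s z)).charpoly = (jacobian f z).charpoly := by
  unfold toFace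
  generalize (i + 2 * s : ℕ) = k
  induction k with
  | zero => rfl
  | succ k ih =>
    rw [Function.iterate_succ_apply', charpoly_jacobian_turn hf hturn (iterate_turn_mem_cube hz k),
      ih]

theorem charpoly_jacobian_facePoint (η : ℝ) (i s : Fin 2) {a : ℝ} (ha : a ∈ Set.Icc (0 : ℝ) 1) :
    (jacobian (twoStep η) (facePoint η i s a)).charpoly =
      X ^ 2 * (X - 1) * (X - C (fourthEigenvalue η a)) := by
  rw [← charpoly_jacobian_toFace (fun z => differentiableAt_twoStep η)
    (fun z => twoStep_toFace η 1 0) i s (facePoint_mem_cube η i s ha), toFace_facePoint,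
    charpoly_jacobian_basePoint η ha]

/-! ### Attraction to the face -/

theorem exists_dist_twoStep_basePoint_lt (η : ℝ) {ε : ℝ} (hε : 0 < ε) :
    ∃ δ > 0, ∀ z ∈ cube, z 3 ∈ Set.Ioo (0 : ℝ) 1 → z 1 < δ →
      ∃ a ∈ Set.Ioo (0 : ℝ) 1, dist (twoStep η z) (basePoint η a) < ε := by
  obtain ⟨δ, hδ, H⟩ := Metric.uniformContinuousOn_iff.1
    (isCompact_cube.uniformContinuousOn_of_continuous (continuousOn_twoStep η)) ε hε
  refine ⟨δ, hδ, fun z hz hz₃ hz₁ => ?_⟩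
  have hw : Function.update z 1 0 ∈ cube := by
    intro k
    rcases eq_or_ne k 1 with rfl | hk
    · simp
    · simpa only [Function.update_of_ne hk] using hz k
  have hdist : dist z (Function.update z 1 0) < δ := by
    refine (dist_pi_lt_iff hδ).2 fun k => ?_
    rcases eq_or_ne k 1 with rfl | hk
    · simpa [Real.dist_eq, abs_of_nonneg (hz 1).1] using hz₁
    · simpa only [Function.update_of_ne hk, dist_self] using hδ
  have hclose := H z hz _ hw hdist
  rw [twoStep_eq_basePoint η hw (Function.update_self ..)] at hclose
  exact ⟨_, tilt_mem_Ioo hz₃ _, hclose⟩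

/-- For both players, the previous and the current strategy differ by no more than one step of the
dynamics can achieve. -/
structure Linked (η : ℝ) (z : Fin 4 → ℝ) : Prop where
  mem_cube : z ∈ cube
  prev_eq_tilt : ∀ j, ∃ d, |d| ≤ 3 * |η| ∧ z (coord j 0) = tilt (z (coord j 1)) d

theorem linked_G₁ (η : ℝ) {z : Fin 4 → ℝ} (hz : z ∈ cube) : Linked η (G₁ η z) := by
  refine ⟨G₁_mem_cube η hz, fun j => ?_⟩
  obtain ⟨d, hd, hstep⟩ := exists_G₁_eq_tilt η hz j
  refine ⟨-d, (abs_neg d).trans_le hd, ?_⟩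
  rw [G₁_coord_zero, hstep, tilt_tilt (hz _), add_neg_cancel, tilt_zero_right]

theorem linked_twoStep (η : ℝ) {z : Fin 4 → ℝ} (hz : z ∈ cube) : Linked η (twoStep η z) := by
  rw [twoStep_apply]
  exact linked_G₁ η (G₁_mem_cube (-η) hz)

theorem Linked.iterate_twoStep {η : ℝ} {z : Fin 4 → ℝ} (hz : Linked η z) (m : ℕ) :
    Linked η ((twoStep η)^[m] z) := by
  cases m with
  | zero => exact hz
  | succ m =>
    rw [Function.iterate_succ_apply']
    exact linked_twoStep η (iterate_twoStep_mem_cube η hz.mem_cube m)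

theorem Linked.prev_le {η : ℝ} {z : Fin 4 → ℝ} (hz : Linked η z) (j : Fin 2) :
    z (coord j 0) ≤ z (coord j 1) * Real.exp (3 * |η|) := by
  obtain ⟨d, hd, hprev⟩ := hz.prev_eq_tilt j
  rw [hprev]
  exact (tilt_le_mul_exp_abs (hz.mem_cube _) d).trans
    (mul_le_mul_of_nonneg_left (Real.exp_le_exp.2 hd) (hz.mem_cube _).1)

theorem tendsto_coord_of_linked {η : ℝ} {w : ℕ → Fin 4 → ℝ} (hw : ∀ m, Linked η (w m)) {j : Fin 2}
    {l : ℝ} (hl : l * (1 - l) = 0) (hlim : Tendsto (fun m => w m (coord j 1)) atTop (𝓝 l))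
    (r : Fin 2) : Tendsto (fun m => w m (coord j r)) atTop (𝓝 l) := by
  suffices hprev : Tendsto (fun m => w m (coord j 0)) atTop (𝓝 l) by
    fin_cases r
    exacts [hprev, hlim]
  have hdist : ∀ m, |w m (coord j 0) - w m (coord j 1)| ≤
      w m (coord j 1) * (1 - w m (coord j 1)) * (Real.exp (3 * |η|) - 1) := fun m => by
    obtain ⟨d, hd, hprev⟩ := (hw m).prev_eq_tilt j
    rw [hprev]
    refine (abs_tilt_sub_self_le ((hw m).mem_cube _) d).trans ?_
    gcongr
    exact mul_one_sub_nonneg ((hw m).mem_cube _)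
  have hbound := (hlim.mul (hlim.const_sub 1)).mul_const (Real.exp (3 * |η|) - 1)
  rw [hl, zero_mul] at hbound
  simpa only [sub_add_cancel, zero_add] using (squeeze_zero_norm hdist hbound).add hlim

theorem drift_le {η q e f : ℝ} (hq : q ∈ Set.Icc (0 : ℝ) 1) (hf : 0 ≤ f) (hfη : f ≤ η)
    (hfexp : Real.exp (3 * η) * (Real.exp f - 1) ≤ (1 - Real.exp (-(2 * η))) / 2)
    (he : e ≤ tilt q (3 * η)) :
    q + e - 2 * tilt q (3 * η - f) ≤ -((1 - Real.exp (-(2 * η))) / 2 * (q * (1 - q))) := by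
  have hvar := mul_one_sub_nonneg hq
  have hgain : q * (1 - q) * (1 - Real.exp (-(2 * η))) ≤ tilt q (3 * η - f) - q := by
    refine le_trans ?_ (mul_one_sub_exp_neg_le_tilt_sub_self hq (by linarith))
    gcongr
    linarith
  have hloss : tilt q (3 * η) - tilt q (3 * η - f) ≤
      q * (1 - q) * ((1 - Real.exp (-(2 * η))) / 2) := by
    have hle := tilt_sub_self_le (tilt_mem_Icc hq (3 * η - f)) hf
    rw [tilt_tilt hq, sub_add_cancel] at hle
    have hvar_le := tilt_mul_one_sub_le hq (3 * η - f)
    rw [abs_of_nonneg (show 0 ≤ 3 * η - f by linarith)] at hvar_le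
    have hexp : 0 ≤ Real.exp f - 1 := sub_nonneg.2 (Real.one_le_exp hf)
    calc tilt q (3 * η) - tilt q (3 * η - f)
        ≤ q * (1 - q) * Real.exp (3 * η - f) * (Real.exp f - 1) :=
          hle.trans (mul_le_mul_of_nonneg_right hvar_le hexp)
      _ ≤ q * (1 - q) * Real.exp (3 * η) * (Real.exp f - 1) := by gcongr; linarith
      _ ≤ q * (1 - q) * ((1 - Real.exp (-(2 * η))) / 2) := by
          rw [mul_assoc]
          exact mul_le_mul_of_nonneg_left hfexp hvar
  linarith

theorem exists_pos_le_exp_mul_le {η : ℝ} (hη : 0 < η) :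
    ∃ f₀ > 0, f₀ ≤ η ∧ Real.exp (3 * η) * (Real.exp f₀ - 1) ≤ (1 - Real.exp (-(2 * η))) / 2 := by
  have hlim : Tendsto (fun f => Real.exp (3 * η) * (Real.exp f - 1)) (𝓝[>] 0) (𝓝 0) := by
    have hcont : Continuous fun f => Real.exp (3 * η) * (Real.exp f - 1) := by fun_prop
    simpa using (hcont.tendsto 0).mono_left nhdsWithin_le_nhds
  have hpos : 0 < (1 - Real.exp (-(2 * η))) / 2 := by
    have hexp : Real.exp (-(2 * η)) < 1 := Real.exp_lt_one_iff.2 (by linarith)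
    linarith
  obtain ⟨f₀, hle, hf₀, hf₀η⟩ :=
    ((hlim.eventually_le_const hpos).and (Ioc_mem_nhdsGT hη)).exists
  exact ⟨f₀, hf₀, hf₀η, hle⟩

theorem exists_twoStep_one_eq_tilt {η : ℝ} (hη : 0 < η) :
    ∃ δ > 0, ∃ c > 0, ∀ z, Linked η z → z 1 ≤ δ →
      ∃ D ≤ -(c * oppVar z), twoStep η z 1 = tilt (z 1) D := by
  obtain ⟨f₀, hf₀, hf₀η, hf₀exp⟩ := exists_pos_le_exp_mul_le hη
  have hc : 0 < 1 - Real.exp (-(2 * η)) := sub_pos.2 (Real.exp_lt_one_iff.2 (by linarith))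
  have hexp : 1 ≤ Real.exp (3 * η) := Real.one_le_exp (by linarith)
  refine ⟨f₀ / (6 * η * Real.exp (3 * η)), by positivity,
    2 * η * ((1 - Real.exp (-(2 * η))) / 2), by positivity, fun z hz hz₁ => ?_⟩
  have hcube := hz.mem_cube
  have hf : 4 * η * z 1 + 2 * η * z 0 ≤ f₀ := by
    have hprev : z 0 ≤ z 1 * Real.exp (3 * |η|) := hz.prev_le 0
    rw [abs_of_pos hη] at hprev
    have hself : z 1 ≤ z 1 * Real.exp (3 * η) := le_mul_of_one_le_right (hcube 1).1 hexp
    rw [le_div_iff₀ (by positivity)] at hz₁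
    nlinarith
  have hprev : z 2 ≤ tilt (z 3) (3 * η) := by
    obtain ⟨d, hd, hprev⟩ := hz.prev_eq_tilt 1
    rw [abs_of_pos hη] at hd
    exact hprev.trans_le (tilt_monotone (hcube 3) ((le_abs_self d).trans hd))
  have hf_nonneg : 0 ≤ 4 * η * z 1 + 2 * η * z 0 :=
    add_nonneg (mul_nonneg (by positivity) (hcube 1).1) (mul_nonneg (by positivity) (hcube 0).1)
  have hdrift := drift_le (hcube 3) hf_nonneg (hf.trans hf₀η) (le_trans (by gcongr) hf₀exp) hprev
  refine ⟨_, ?_, twoStep_apply_one η hcube⟩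
  rw [twoStep_apply_two, sub_sub, mul_assoc (2 * η) (_ / 2), ← mul_neg]
  exact mul_le_mul_of_nonneg_left hdrift (by positivity)

theorem Linked.exists_twoStep_three_eq_tilt {η : ℝ} {z : Fin 4 → ℝ} (hz : Linked η z) :
    ∃ S, |S| ≤ 4 * |η| * Real.exp (3 * |η|) * z 1 ∧ twoStep η z 3 = tilt (z 3) S := by
  have hcube := hz.mem_cube
  refine ⟨_, ?_, twoStep_apply_three η hcube⟩
  have hexp : z 1 ≤ z 1 * Real.exp (3 * |η|) :=
    le_mul_of_one_le_right (hcube 1).1 (Real.one_le_exp (by positivity))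
  have hnext_nonneg := (twoStep_mem_cube η hcube 0).1
  have hnext : twoStep η z 0 ≤ z 1 * Real.exp (3 * |η|) := by
    rw [twoStep_apply, ← abs_neg η]
    exact (G₁_coord_zero η _ 0).trans_le (G₁_one_le (-η) hcube)
  have hprev : z 0 ≤ z 1 * Real.exp (3 * |η|) := hz.prev_le 0
  have habs : |2 * twoStep η z 0 - z 1 - z 0| ≤ 2 * (z 1 * Real.exp (3 * |η|)) :=
    abs_le.2 ⟨by linarith, by linarith [(hcube 0).1, (hcube 1).1]⟩
  rw [abs_mul, abs_mul, abs_two]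
  calc 2 * |η| * |2 * twoStep η z 0 - z 1 - z 0|
      ≤ 2 * |η| * (2 * (z 1 * Real.exp (3 * |η|))) := by gcongr
    _ = 4 * |η| * Real.exp (3 * |η|) * z 1 := by ring

theorem exists_iterate_twoStep_one_eq_tilt {η : ℝ} (hη : 0 < η) :
    ∃ δ > 0, ∃ c > 0, ∀ z, Linked η z → z 1 ≤ δ → ∀ m,
      ∃ D ≤ -(c * ∑ k ∈ Finset.range m, oppVar ((twoStep η)^[k] z)),
        (twoStep η)^[m] z 1 = tilt (z 1) D := by
  obtain ⟨δ, hδ, c, hc, H⟩ := exists_twoStep_one_eq_tilt hη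
  refine ⟨δ, hδ, c, hc, fun z hz hz₁ m => ?_⟩
  induction m with
  | zero => exact ⟨0, by simp, (tilt_zero_right _).symm⟩
  | succ m ih =>
    obtain ⟨D, hD, hm⟩ := ih
    have hD_nonpos : D ≤ 0 := hD.trans <| neg_nonpos.2 <| mul_nonneg hc.le <|
      Finset.sum_nonneg fun k _ => oppVar_nonneg (iterate_twoStep_mem_cube η hz.mem_cube k)
    have hle : (twoStep η)^[m] z 1 ≤ δ := by
      rw [hm]
      exact ((tilt_monotone (hz.mem_cube 1) hD_nonpos).trans_eq (tilt_zero_right _)).trans hz₁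
    obtain ⟨E, hE, hstep⟩ := H _ (hz.iterate_twoStep m) hle
    refine ⟨D + E, ?_, ?_⟩
    · rw [Finset.sum_range_succ, mul_add, neg_add]
      exact add_le_add hD hE
    · rw [Function.iterate_succ_apply', hstep, hm, tilt_tilt (hz.mem_cube 1)]

theorem Linked.exists_iterate_twoStep_three_eq_tilt {η : ℝ} {z : Fin 4 → ℝ} (hz : Linked η z)
    (m : ℕ) :
    ∃ S, |S| ≤ 4 * |η| * Real.exp (3 * |η|) * ∑ k ∈ Finset.range m, (twoStep η)^[k] z 1 ∧
      (twoStep η)^[m] z 3 = tilt (z 3) S := by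
  induction m with
  | zero => exact ⟨0, by simp, (tilt_zero_right _).symm⟩
  | succ m ih =>
    obtain ⟨S, hS, hm⟩ := ih
    obtain ⟨T, hT, hstep⟩ := (hz.iterate_twoStep m).exists_twoStep_three_eq_tilt
    refine ⟨S + T, ?_, ?_⟩
    · rw [Finset.sum_range_succ, mul_add]
      exact (abs_add_le S T).trans (add_le_add hS hT)
    · rw [Function.iterate_succ_apply', hstep, hm, tilt_tilt (hz.mem_cube 3)]

theorem exists_tendsto_of_not_summable_oppVar {η : ℝ} (hη : 0 < η) :
    ∃ δ > 0, ∀ z, Linked η z → z 1 ≤ δ → ¬ Summable (fun m => oppVar ((twoStep η)^[m] z)) →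
      ∀ r, Tendsto (fun m => (twoStep η)^[m] z (coord 0 r)) atTop (𝓝 0) := by
  obtain ⟨δ, hδ, c, hc, H⟩ := exists_iterate_twoStep_one_eq_tilt hη
  refine ⟨min δ (1 / 2), by positivity, fun z hz hz₁ hsum => ?_⟩
  have hmem := iterate_twoStep_mem_cube η hz.mem_cube
  refine tendsto_coord_of_linked hz.iterate_twoStep (by simp) ?_
  have hdiv : Tendsto (fun m => ∑ k ∈ Finset.range m, oppVar ((twoStep η)^[k] z)) atTop atTop :=
    (not_summable_iff_tendsto_nat_atTop_of_nonneg fun m => oppVar_nonneg (hmem m)).1 hsum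
  have hbound : Tendsto (fun m => 2 * z 1 *
      Real.exp (-(c * ∑ k ∈ Finset.range m, oppVar ((twoStep η)^[k] z)))) atTop (𝓝 0) := by
    simpa using (Real.tendsto_exp_neg_atTop_nhds_zero.comp
      (hdiv.const_mul_atTop hc)).const_mul (2 * z 1)
  refine squeeze_zero (fun m => (hmem m 1).1) (fun m => ?_) hbound
  obtain ⟨D, hD, hm⟩ := H z hz (hz₁.trans (min_le_left ..)) m
  have hz_nonneg := (hz.mem_cube 1).1
  change (twoStep η)^[m] z 1 ≤ _
  rw [hm]
  refine (tilt_le_two_mul_exp hz_nonneg (hz₁.trans (min_le_right ..)) D).trans ?_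
  gcongr

theorem exists_sum_iterate_twoStep_one_le {η : ℝ} (hη : 0 < η) {ν : ℝ} (hν : 0 < ν) :
    ∃ δ > 0, ∃ C > 0, ∀ z, Linked η z → z 1 ≤ δ →
      ∀ m, (∀ k < m, ν ≤ oppVar ((twoStep η)^[k] z)) →
        ∑ k ∈ Finset.range m, (twoStep η)^[k] z 1 ≤ C * z 1 := by
  obtain ⟨δ, hδ, c, hc, H⟩ := exists_iterate_twoStep_one_eq_tilt hη
  set r := Real.exp (-(c * ν))
  have hr₁ : 0 < 1 - r := sub_pos.2 (Real.exp_lt_one_iff.2 (neg_neg_iff_pos.2 (by positivity)))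
  refine ⟨min δ (1 / 2), by positivity, 2 / (1 - r), by positivity, fun z hz hz₁ m hm => ?_⟩
  have hz_nonneg := (hz.mem_cube 1).1
  have hgeom : ∀ k ∈ Finset.range m, (twoStep η)^[k] z 1 ≤ 2 * z 1 * r ^ k := fun k hk => by
    obtain ⟨D, hD, hDk⟩ := H z hz (hz₁.trans (min_le_left ..)) k
    have hsum : k * ν ≤ ∑ j ∈ Finset.range k, oppVar ((twoStep η)^[j] z) := by
      simpa only [Finset.card_range, nsmul_eq_mul] using
        Finset.card_nsmul_le_sum (Finset.range k) _ ν fun j hj =>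
          hm j ((Finset.mem_range.1 hj).trans (Finset.mem_range.1 hk))
    have hDν : D ≤ k * -(c * ν) := by linarith [mul_le_mul_of_nonneg_left hsum hc.le]
    rw [hDk, ← Real.exp_nat_mul]
    exact (tilt_le_two_mul_exp hz_nonneg (hz₁.trans (min_le_right ..)) D).trans (by gcongr)
  have hpow : ∑ k ∈ Finset.range m, r ^ k ≤ 1 / (1 - r) := by
    rw [le_div_iff₀' hr₁, mul_neg_geom_sum]
    exact sub_le_self 1 (by positivity)
  calc ∑ k ∈ Finset.range m, (twoStep η)^[k] z 1
      ≤ 2 * z 1 * ∑ k ∈ Finset.range m, r ^ k :=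
        (Finset.sum_le_sum hgeom).trans_eq (Finset.mul_sum ..).symm
    _ ≤ 2 * z 1 * (1 / (1 - r)) := by gcongr
    _ = 2 / (1 - r) * z 1 := by ring

theorem exists_forall_le_oppVar_iterate {η : ℝ} (hη : 0 < η) {κ : ℝ} (hκ : 0 < κ) :
    ∃ δ > 0, ∀ z, Linked η z → z 1 ≤ δ → κ ≤ oppVar z →
      ∀ m, κ * Real.exp (-1) ≤ oppVar ((twoStep η)^[m] z) := by
  have hν : 0 < κ * Real.exp (-1) := by positivity
  obtain ⟨δ, hδ, C, hC, H⟩ := exists_sum_iterate_twoStep_one_le hη hν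
  set K := 4 * |η| * Real.exp (3 * |η|)
  have hK₀ : 0 < K := by positivity
  refine ⟨min δ (1 / (K * C)), by positivity, fun z hz hz₁ hκz m => ?_⟩
  induction m using Nat.strong_induction_on with
  | _ m ih =>
    obtain ⟨S, hS, hSm⟩ := hz.exists_iterate_twoStep_three_eq_tilt m
    have hS₁ : |S| ≤ 1 := by
      calc |S| ≤ K * (C * z 1) :=
            hS.trans (mul_le_mul_of_nonneg_left (H z hz (hz₁.trans (min_le_left ..)) m ih) hK₀.le)
        _ ≤ K * (C * (1 / (K * C))) := by gcongr; exact hz₁.trans (min_le_right ..)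
        _ = 1 := by field_simp
    have hvar := oppVar_nonneg hz.mem_cube
    calc κ * Real.exp (-1) ≤ oppVar z * Real.exp (-|S|) := by gcongr
      _ ≤ oppVar ((twoStep η)^[m] z) := by
          rw [oppVar, oppVar, hSm]
          exact mul_exp_neg_abs_le_tilt_mul_one_sub (hz.mem_cube 3) S

theorem exists_tendsto_of_summable_oppVar {η : ℝ} {z : Fin 4 → ℝ} (hz : Linked η z)
    (hsum : Summable fun m => oppVar ((twoStep η)^[m] z)) :
    ∃ l, l * (1 - l) = 0 ∧
      ∀ r, Tendsto (fun m => (twoStep η)^[m] z (coord 1 r)) atTop (𝓝 l) := by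
  have hmem := iterate_twoStep_mem_cube η hz.mem_cube
  have hdist : ∀ m, dist ((twoStep η)^[m] z 3) ((twoStep η)^[m + 1] z 3) ≤
      oppVar ((twoStep η)^[m] z) * (Real.exp (6 * |η|) - 1) := fun m => by
    obtain ⟨d, hd, hstep⟩ := exists_twoStep_eq_tilt η (hmem m) 1
    change twoStep η _ 3 = tilt _ d at hstep
    rw [Function.iterate_succ_apply', hstep, dist_comm]
    refine (abs_tilt_sub_self_le (hmem m 3) d).trans ?_
    exact mul_le_mul_of_nonneg_left (sub_le_sub_right (Real.exp_le_exp.2 hd) 1)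
      (oppVar_nonneg (hmem m))
  obtain ⟨l, hl⟩ := cauchySeq_tendsto_of_complete <|
    cauchySeq_of_dist_le_of_summable _ hdist (hsum.mul_right _)
  have hvar : l * (1 - l) = 0 :=
    tendsto_nhds_unique (hl.mul (hl.const_sub 1)) hsum.tendsto_atTop_zero
  exact ⟨l, hvar, tendsto_coord_of_linked hz.iterate_twoStep hvar hl⟩

theorem tendsto_iterate_twoStep_succ_iff {η : ℝ} {z : Fin 4 → ℝ} {k : Fin 4} {l : ℝ} :
    Tendsto (fun m => (twoStep η)^[m] (twoStep η z) k) atTop (𝓝 l) ↔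
      Tendsto (fun m => (twoStep η)^[m] z k) atTop (𝓝 l) := by
  simp only [← Function.iterate_succ_apply]
  exact tendsto_add_atTop_iff_nat (f := fun m => (twoStep η)^[m] z k) 1

theorem exists_tendsto_of_le_oppVar {η : ℝ} (hη : 0 < η) {κ : ℝ} (hκ : 0 < κ) :
    ∃ δ > 0, ∀ z ∈ cube, z 1 < δ → κ ≤ oppVar z →
      ∀ r, Tendsto (fun m => (twoStep η)^[m] z (coord 0 r)) atTop (𝓝 0) := by
  have hκ' : 0 < κ * Real.exp (-(6 * |η|)) := by positivity
  obtain ⟨δ₁, hδ₁, hstay⟩ := exists_forall_le_oppVar_iterate hη hκ'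
  obtain ⟨δ₂, hδ₂, hattract⟩ := exists_tendsto_of_not_summable_oppVar hη
  refine ⟨min δ₁ δ₂ * Real.exp (-(6 * |η|)), by positivity, fun z hz hz₁ hκz r => ?_⟩
  rw [← tendsto_iterate_twoStep_succ_iff]
  have hlinked := linked_twoStep η hz
  obtain ⟨hle₁, hle₂⟩ := le_min_iff.1 (twoStep_one_le_of_lt hz hz₁)
  have hκz' : κ * Real.exp (-(6 * |η|)) ≤ oppVar (twoStep η z) :=
    le_trans (by gcongr) (oppVar_mul_exp_le_oppVar_twoStep η hz)
  refine hattract _ hlinked hle₂ (fun hsum => ?_) r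
  exact (mul_pos hκ' (Real.exp_pos (-1))).not_ge <|
    ge_of_tendsto' hsum.tendsto_atTop_zero (hstay _ hlinked hle₁ hκz')

theorem exists_tendsto_or_tendsto {η : ℝ} (hη : 0 < η) :
    ∃ δ > 0, ∀ z ∈ cube, z 1 < δ →
      (∀ r, Tendsto (fun m => (twoStep η)^[m] z (coord 0 r)) atTop (𝓝 0)) ∨
        ∃ l, l * (1 - l) = 0 ∧
          ∀ r, Tendsto (fun m => (twoStep η)^[m] z (coord 1 r)) atTop (𝓝 l) := by
  obtain ⟨δ, hδ, hattract⟩ := exists_tendsto_of_not_summable_oppVar hη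
  refine ⟨δ * Real.exp (-(6 * |η|)), by positivity, fun z hz hz₁ => ?_⟩
  simp only [← tendsto_iterate_twoStep_succ_iff (z := z)]
  have hlinked := linked_twoStep η hz
  by_cases hsum : Summable fun m => oppVar ((twoStep η)^[m] (twoStep η z))
  · exact .inr (exists_tendsto_of_summable_oppVar hlinked hsum)
  · exact .inl (hattract _ hlinked (twoStep_one_le_of_lt hz hz₁) hsum)

theorem exists_tendsto_near_basePoint {η : ℝ} (hη : 0 < η) {a : ℝ} (ha : a ∈ Set.Ioo (0 : ℝ) 1) :
    ∃ ρ > 0, ∀ z ∈ cube, dist z (basePoint η a) < ρ →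
      ∀ r, Tendsto (fun m => (twoStep η)^[m] z (coord 0 r)) atTop (𝓝 0) := by
  have hvar : 0 < oppVar (basePoint η a) := by
    have hshift : shift η a ∈ Set.Ioo (0 : ℝ) 1 := shift_eq_tilt η a ▸ tilt_mem_Ioo ha _
    exact mul_pos hshift.1 (sub_pos.2 hshift.2)
  obtain ⟨δ, hδ, H⟩ := exists_tendsto_of_le_oppVar hη (half_pos hvar)
  have hcont : Continuous oppVar := by unfold oppVar; fun_prop
  have hnear₁ : ∀ᶠ z in 𝓝 (basePoint η a), z 1 < δ :=
    (continuous_apply 1).continuousAt.eventually_lt_const hδ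
  have hnear₃ : ∀ᶠ z in 𝓝 (basePoint η a), oppVar (basePoint η a) / 2 < oppVar z :=
    hcont.continuousAt.eventually_const_lt (half_lt_self hvar)
  obtain ⟨ρ, hρ, hball⟩ := Metric.eventually_nhds_iff.1 (hnear₁.and hnear₃)
  exact ⟨ρ, hρ, fun z hz hdist => H z hz (hball hdist).1 (hball hdist).2.le⟩

theorem exists_tendsto_near_facePoint {η : ℝ} (hη : 0 < η) (i s : Fin 2) {a : ℝ}
    (ha : a ∈ Set.Ioo (0 : ℝ) 1) :
    ∃ ρ > 0, ∀ z ∈ cube, dist z (facePoint η i s a) < ρ →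
      ∀ r, Tendsto (fun m => (twoStep η)^[m] z (coord i r)) atTop (𝓝 (![0, 1] s)) := by
  obtain ⟨ρ, hρ, H⟩ := exists_tendsto_near_basePoint hη ha
  refine ⟨ρ, hρ, fun z hz hdist r => ?_⟩
  rw [← (isometry_toFace i s).dist_eq, toFace_facePoint] at hdist
  have hlim := H _ (toFace_mem_cube i s hz) hdist r
  simp only [iterate_twoStep_toFace η i s hz, toFace_coord, add_zero, mul_zero] at hlim
  fin_cases s
  · exact hlim
  · simpa using hlim.const_sub 1

theorem exists_dist_twoStep_facePoint_lt (η : ℝ) (i s : Fin 2) {ε : ℝ} (hε : 0 < ε) :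
    ∃ δ > 0, ∀ z ∈ cube, toFace i s z 3 ∈ Set.Ioo (0 : ℝ) 1 → toFace i s (twoStep η z) 1 < δ →
      ∃ a ∈ Set.Ioo (0 : ℝ) 1, dist (twoStep η z) (facePoint η i s a) < ε := by
  obtain ⟨δ, hδ, H⟩ := exists_dist_twoStep_basePoint_lt η hε
  refine ⟨δ * Real.exp (-(6 * |η|)), by positivity, fun z hz hz₃ hz₁ => ?_⟩
  have hface := toFace_mem_cube i s hz
  rw [← twoStep_toFace η i s hz] at hz₁
  obtain ⟨a, ha, hdist⟩ := H _ hface hz₃ (lt_of_twoStep_one_lt hface hz₁)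
  refine ⟨a, ha, ?_⟩
  rwa [← (isometry_toFace i s).dist_eq, toFace_facePoint, ← twoStep_toFace η i s hz]

/-! ### Orbits of the periodic dynamics -/

theorem tendsto_int_of_tendsto_even_of_tendsto_odd {α : Type*} {f : ℤ → α} {l : Filter α} {N : ℤ}
    (heven : Tendsto (fun m : ℕ => f (N + 2 * m)) atTop l)
    (hodd : Tendsto (fun m : ℕ => f (N + 2 * m + 1)) atTop l) : Tendsto f atTop l := by
  intro s hs
  obtain ⟨a, ha⟩ := mem_atTop_sets.1 (heven hs)
  obtain ⟨b, hb⟩ := mem_atTop_sets.1 (hodd hs)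
  refine mem_atTop_sets.2 ⟨N + 2 * (a + b), fun t ht => ?_⟩
  obtain ⟨k, hk | hk⟩ := Int.even_or_odd' (t - N)
  · lift k to ℕ using by omega
    obtain rfl : t = N + 2 * k := by omega
    exact ha k (by omega)
  · lift k to ℕ using by omega
    obtain rfl : t = N + 2 * k + 1 := by omega
    exact hb k (by omega)

/-- A sequence of iterate vectors that follows the dynamics from time `0` on.  Since
`G₂ η = G₁ (-η)`, the alternation of the two maps is a sign change of the step size. -/
structure IsOrbit (η : ℝ) (z : ℤ → Fin 4 → ℝ) : Prop where
  mem_cube : ∀ n, 0 ≤ n → z n ∈ cube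
  step : ∀ n, 0 ≤ n → z (n + 1) = G₁ (if Even n then -η else η) (z n)

namespace IsOrbit

variable {η : ℝ} {z : ℤ → Fin 4 → ℝ} {n : ℤ}

theorem toFace (hz : IsOrbit η z) (i s : Fin 2) : IsOrbit η fun n => toFace i s (z n) where
  mem_cube n hn := toFace_mem_cube i s (hz.mem_cube n hn)
  step n hn := by rw [hz.step n hn, G₁_toFace _ i s (hz.mem_cube n hn)]

theorem add_two (hz : IsOrbit η z) (hn : 0 ≤ n) (heven : Even n) : z (n + 2) = twoStep η (z n) := by
  have hodd : ¬ Even (n + 1) := Int.not_even_iff_odd.2 heven.add_one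
  rw [show n + 2 = n + 1 + 1 by ring, hz.step (n + 1) (by omega), hz.step n hn, if_neg hodd,
    if_pos heven, twoStep_apply]

theorem add_two_mul (hz : IsOrbit η z) (hn : 0 ≤ n) (heven : Even n) (m : ℕ) :
    z (n + 2 * m) = (twoStep η)^[m] (z n) := by
  induction m with
  | zero => simp
  | succ m ih =>
    rw [Function.iterate_succ_apply', ← ih,
      ← hz.add_two (by omega) (heven.add (even_two_mul (m : ℤ)))]
    push_cast
    ring_nf

theorem tendsto_coord (hz : IsOrbit η z) (hn : 0 ≤ n) (heven : Even n) {j : Fin 2} {l : ℝ}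
    (hlim : ∀ r, Tendsto (fun m => (twoStep η)^[m] (z n) (coord j r)) atTop (𝓝 l)) :
    Tendsto (fun t => z t (coord j 1)) atTop (𝓝 l) := by
  simp only [← hz.add_two_mul hn heven] at hlim
  refine tendsto_int_of_tendsto_even_of_tendsto_odd (hlim 1) ?_
  refine ((tendsto_add_atTop_iff_nat 1).2 (hlim 0)).congr fun m => ?_
  have hprev : z (n + 2 * m + 1 + 1) (coord j 0) = z (n + 2 * m + 1) (coord j 1) := by
    rw [hz.step _ (by omega), G₁_coord_zero]
  rw [← hprev]
  push_cast
  ring_nf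

theorem exists_even (hz : IsOrbit η z) (hn : 0 ≤ n) :
    ∃ N, 0 ≤ N ∧ Even N ∧ z N 1 ≤ z n 1 * Real.exp (3 * |η|) ∧
      oppVar (z n) * Real.exp (-(3 * |η|)) ≤ oppVar (z N) := by
  have hcube := hz.mem_cube n hn
  rcases Int.even_or_odd n with heven | hodd
  · exact ⟨n, hn, heven, le_mul_of_one_le_right (hcube 1).1 (Real.one_le_exp (by positivity)),
      mul_le_of_le_one_right (oppVar_nonneg hcube) (Real.exp_le_one_iff.2 (by simp))⟩
  · refine ⟨n + 1, by omega, hodd.add_one, ?_⟩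
    rw [hz.step n hn, if_neg (Int.not_even_iff_odd.2 hodd)]
    exact ⟨G₁_one_le η hcube, oppVar_mul_exp_le_oppVar_G₁ η hcube⟩

end IsOrbit

theorem exists_isOrbit_tendsto_of_le_oppVar {η : ℝ} (hη : 0 < η) {κ : ℝ} (hκ : 0 < κ) :
    ∃ δ > 0, ∀ z, IsOrbit η z → ∀ n, 0 ≤ n → z n 1 < δ → κ ≤ oppVar (z n) →
      Tendsto (fun t => z t 1) atTop (𝓝 0) := by
  obtain ⟨δ, hδ, H⟩ :=
    exists_tendsto_of_le_oppVar hη (show 0 < κ * Real.exp (-(3 * |η|)) by positivity)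
  refine ⟨δ / Real.exp (3 * |η|), by positivity, fun z hz n hn hz₁ hκz => ?_⟩
  obtain ⟨N, hN, heven, hle, hvar⟩ := hz.exists_even hn
  rw [lt_div_iff₀ (Real.exp_pos _)] at hz₁
  have hκN : κ * Real.exp (-(3 * |η|)) ≤ oppVar (z N) := le_trans (by gcongr) hvar
  exact hz.tendsto_coord (j := 0) hN heven
    (H _ (hz.mem_cube N hN) (hle.trans_lt hz₁) hκN)

theorem exists_isOrbit_tendsto_or_tendsto {η : ℝ} (hη : 0 < η) :
    ∃ δ > 0, ∀ z, IsOrbit η z → ∀ n, 0 ≤ n → z n 1 < δ →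
      Tendsto (fun t => z t 1) atTop (𝓝 0) ∨
        ∃ l, l * (1 - l) = 0 ∧ Tendsto (fun t => z t 3) atTop (𝓝 l) := by
  obtain ⟨δ, hδ, H⟩ := exists_tendsto_or_tendsto hη
  refine ⟨δ / Real.exp (3 * |η|), by positivity, fun z hz n hn hz₁ => ?_⟩
  obtain ⟨N, hN, heven, hle, -⟩ := hz.exists_even hn
  rw [lt_div_iff₀ (Real.exp_pos _)] at hz₁
  refine (H _ (hz.mem_cube N hN) (hle.trans_lt hz₁)).imp (hz.tendsto_coord (j := 0) hN heven) ?_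
  rintro ⟨l, hl, hlim⟩
  exact ⟨l, hl, hz.tendsto_coord (j := 1) hN heven hlim⟩

/-! ### Trajectories of the algorithm -/

theorem mwStep_pos {w : Fin 2 → ℝ} (hw : ∀ s, 0 < w s) (g : Fin 2 → ℝ) (s : Fin 2) :
    0 < mwStep w g s :=
  div_pos (mul_pos (hw s) (Real.exp_pos _)) <|
    Finset.sum_pos (fun r _ => mul_pos (hw r) (Real.exp_pos _)) Finset.univ_nonempty

theorem sum_mwStep {w : Fin 2 → ℝ} (hw : ∀ s, 0 < w s) (g : Fin 2 → ℝ) :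
    ∑ s, mwStep w g s = 1 := by
  have hsum : 0 < ∑ r, w r * Real.exp (g r) :=
    Finset.sum_pos (fun r _ => mul_pos (hw r) (Real.exp_pos _)) Finset.univ_nonempty
  simp only [mwStep]
  rw [← Finset.sum_div, div_self hsum.ne']

theorem mwStep_zero {w : Fin 2 → ℝ} (hw : w 1 = 1 - w 0) (g : Fin 2 → ℝ) :
    mwStep w g 0 = tilt (w 0) (g 0 - g 1) := by
  rw [mwStep, Fin.sum_univ_two, hw, mul_exp_div_eq_tilt]

theorem payoff_transpose (t : ℤ) : (payoff t).transpose = payoff t := by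
  unfold payoff
  split_ifs <;> exact Matrix.ext fun i j => by fin_cases i <;> fin_cases j <;> rfl

theorem payoff_mulVec_zero_sub_one {v : Fin 2 → ℝ} (hv : v 1 = 1 - v 0) (t : ℤ) :
    (payoff t).mulVec v 0 - (payoff t).mulVec v 1 = (if Even t then -1 else 1) * (1 - 2 * v 0) := by
  unfold payoff
  split_ifs <;> simp only [Matrix.mulVec, dotProduct, Fin.sum_univ_two, Matrix.of_apply,
    Matrix.cons_val_zero, Matrix.cons_val_one, hv] <;> ring

theorem KL_equilibrium_eq {q : Fin 2 → Fin 2 → ℝ} (hq : ∀ i s, 0 < q i s) :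
    KL equilibrium q = 1 / 2 * ∑ i, ∑ s, -Real.log (q i s) + 2 * Real.log (1 / 2) := by
  have hdiv : ∀ i s, Real.log (1 / 2 / q i s) = Real.log (1 / 2) - Real.log (q i s) := fun i s =>
    Real.log_div (by norm_num) (hq i s).ne'
  simp only [KL, equilibrium, hdiv, Fin.sum_univ_two]
  ring

theorem tendsto_KL_equilibrium {ι : Type*} {L : Filter ι} {q : ι → Fin 2 → Fin 2 → ℝ}
    (hq : ∀ᶠ t in L, ∀ i s, q t i s ∈ Set.Ioc (0 : ℝ) 1) {i s : Fin 2}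
    (hlim : Tendsto (fun t => q t i s) L (𝓝 0)) :
    Tendsto (fun t => KL equilibrium (q t)) L atTop := by
  have hpos : Tendsto (fun t => q t i s) L (𝓝[>] 0) :=
    tendsto_nhdsWithin_iff.2 ⟨hlim, hq.mono fun t ht => (ht i s).1⟩
  have hlog : Tendsto (fun t => 1 / 2 * -Real.log (q t i s) + 2 * Real.log (1 / 2)) L atTop :=
    tendsto_atTop_add_const_right _ _ <| Tendsto.const_mul_atTop (by norm_num) <|
      tendsto_neg_atBot_atTop.comp (Real.tendsto_log_nhdsGT_zero.comp hpos)
  refine tendsto_atTop_mono' _ (hq.mono fun t ht => ?_) hlog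
  have hterm : ∀ j r, 0 ≤ -Real.log (q t j r) := fun j r =>
    neg_nonneg.2 (Real.log_nonpos (ht j r).1.le (ht j r).2)
  refine le_of_le_of_eq ?_ (KL_equilibrium_eq fun j r => (ht j r).1).symm
  gcongr
  calc -Real.log (q t i s) ≤ ∑ r, -Real.log (q t i r) :=
        Finset.single_le_sum (f := fun r => -Real.log (q t i r)) (fun r _ => hterm i r)
          (Finset.mem_univ s)
    _ ≤ ∑ j, ∑ r, -Real.log (q t j r) :=
        Finset.single_le_sum (f := fun j => ∑ r, -Real.log (q t j r))
          (fun j _ => Finset.sum_nonneg fun r _ => hterm j r) (Finset.mem_univ i)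

namespace IsOMWU

variable {η : ℝ} {x : ℤ → Fin 2 → Fin 2 → ℝ} {n : ℤ}

theorem pos (h : IsOMWU η x) (hn : 0 ≤ n) : ∀ i s, 0 < x n i s := by
  induction n, hn using Int.leInduction with
  | base => exact h.init_pos
  | succ t ht ih =>
    intro i
    fin_cases i
    · change ∀ s, 0 < x (t + 1) 0 s
      rw [h.step_fst t ht]
      exact mwStep_pos (ih 0) _
    · change ∀ s, 0 < x (t + 1) 1 s
      rw [h.step_snd t ht]
      exact mwStep_pos (ih 1) _

theorem sum_eq_one (h : IsOMWU η x) (hn : -1 ≤ n) (i : Fin 2) : ∑ s, x n i s = 1 := by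
  rcases hn.eq_or_lt with rfl | hn
  · exact (h.prev_mem i).2
  rcases (show 0 ≤ n by omega).eq_or_lt with rfl | hn
  · exact (h.init_mem i).2
  obtain ⟨t, rfl⟩ : ∃ t, n = t + 1 := ⟨n - 1, by ring⟩
  have ht : 0 ≤ t := by omega
  fin_cases i
  · change ∑ s, x (t + 1) 0 s = 1
    rw [h.step_fst t ht]
    exact sum_mwStep (h.pos ht 0) _
  · change ∑ s, x (t + 1) 1 s = 1
    rw [h.step_snd t ht]
    exact sum_mwStep (h.pos ht 1) _

theorem one_sub_eq (h : IsOMWU η x) (hn : -1 ≤ n) (i s : Fin 2) : 1 - x n i s = x n i (1 + s) := by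
  have hsum := h.sum_eq_one hn i
  rw [Fin.sum_univ_two] at hsum
  fin_cases s
  · change 1 - x n i 0 = x n i 1
    linarith
  · change 1 - x n i 1 = x n i 0
    linarith

theorem mem_Icc (h : IsOMWU η x) (hn : -1 ≤ n) (i s : Fin 2) : x n i s ∈ Set.Icc (0 : ℝ) 1 := by
  have hnonneg : ∀ s, 0 ≤ x n i s := by
    rcases hn.eq_or_lt with rfl | hn
    · exact (h.prev_mem i).1
    · exact fun s => (h.pos (by omega) i s).le
  refine ⟨hnonneg s, sub_nonneg.1 ?_⟩
  rw [h.one_sub_eq hn]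
  exact hnonneg _

theorem mem_Ioo (h : IsOMWU η x) (hn : 0 ≤ n) (i s : Fin 2) : x n i s ∈ Set.Ioo (0 : ℝ) 1 := by
  refine ⟨h.pos hn i s, sub_pos.1 ?_⟩
  rw [h.one_sub_eq (by omega)]
  exact h.pos hn i _

theorem succ_fst_zero (h : IsOMWU η x) (hn : 0 ≤ n) {ε : ℝ} (hε : ε = if Even n then -η else η) :
    x (n + 1) 0 0 = tilt (x n 0 0) (3 * ε - 4 * ε * x n 1 0 - 2 * ε * x (n - 1) 1 0) := by
  have hcur := payoff_mulVec_zero_sub_one (h.one_sub_eq (n := n) (by omega) 1 0).symm n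
  have hprev :=
    payoff_mulVec_zero_sub_one (h.one_sub_eq (n := n - 1) (by omega) 1 0).symm (n - 1)
  rw [h.step_fst n hn, mwStep_zero (h.one_sub_eq (by omega) 0 0).symm, hε]
  rw [if_congr Int.even_sub_one rfl rfl, ite_not] at hprev
  congr 1
  split_ifs at * <;> linear_combination 2 * η * hcur - η * hprev

theorem succ_snd_zero (h : IsOMWU η x) (hn : 0 ≤ n) {ε : ℝ} (hε : ε = if Even n then -η else η) :
    x (n + 1) 1 0 = tilt (x n 1 0) (-(3 * ε) + 4 * ε * x n 0 0 + 2 * ε * x (n - 1) 0 0) := by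
  have hcur := payoff_mulVec_zero_sub_one (h.one_sub_eq (n := n) (by omega) 0 0).symm n
  have hprev :=
    payoff_mulVec_zero_sub_one (h.one_sub_eq (n := n - 1) (by omega) 0 0).symm (n - 1)
  rw [h.step_snd n hn, mwStep_zero (h.one_sub_eq (by omega) 1 0).symm, hε]
  rw [if_congr Int.even_sub_one rfl rfl, ite_not] at hprev
  simp only [payoff_transpose]
  congr 1
  split_ifs at * <;> linear_combination -2 * η * hcur + η * hprev

theorem isOrbit_iterVec (h : IsOMWU η x) : IsOrbit η (iterVec x) where
  mem_cube n hn k := by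
    fin_cases k
    exacts [h.mem_Icc (by omega) 0 0, h.mem_Icc (by omega) 0 0, h.mem_Icc (by omega) 1 0,
      h.mem_Icc (by omega) 1 0]
  step n hn := by
    rw [G₁_eq, iterVec, add_sub_cancel_right, h.succ_fst_zero hn rfl, h.succ_snd_zero hn rfl]
    rfl

theorem toFace_iterVec (h : IsOMWU η x) (hn : -1 ≤ n) (i s j : Fin 2) :
    toFace i s (iterVec x n) (coord j 1) = x n (i + j) (s + i * j) := by
  have hcoord : ∀ k, iterVec x n (coord k 1) = x n k 0 := fun k => by fin_cases k <;> rfl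
  rw [toFace_coord, hcoord, h.one_sub_eq hn]
  generalize s + i * j = s'
  fin_cases s' <;> rfl

theorem toFace_iterVec_one (h : IsOMWU η x) (hn : -1 ≤ n) (i s : Fin 2) :
    toFace i s (iterVec x n) 1 = x n i s := by
  have hcoord := h.toFace_iterVec hn i s 0
  rwa [add_zero, mul_zero, add_zero] at hcoord

theorem toFace_iterVec_three (h : IsOMWU η x) (hn : -1 ≤ n) (i s : Fin 2) :
    toFace i s (iterVec x n) 3 = x n (1 + i) (s + i) := by
  have hcoord := h.toFace_iterVec hn i s 1
  rwa [mul_one, add_comm i] at hcoord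

theorem tendsto_KL (h : IsOMWU η x) {i s : Fin 2} (hlim : Tendsto (fun t => x t i s) atTop (𝓝 0)) :
    Tendsto (fun t => KL equilibrium (x t)) atTop atTop :=
  tendsto_KL_equilibrium ((eventually_ge_atTop 0).mono fun _ ht i s =>
    Set.Ioo_subset_Ioc_self (h.mem_Ioo ht i s)) hlim

end IsOMWU

theorem exists_dist_iterVec_facePoint_lt (η : ℝ) (i s : Fin 2) {ε : ℝ} (hε : 0 < ε) :
    ∃ δ > 0, ∀ x, IsOMWU η x → ∀ n : ℤ, 2 ≤ n → Even n → x n i s < δ →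
      ∃ a ∈ Set.Ioo (0 : ℝ) 1, dist (iterVec x n) (facePoint η i s a) < ε := by
  obtain ⟨δ, hδ, H⟩ := exists_dist_twoStep_facePoint_lt η i s hε
  refine ⟨δ, hδ, fun x h n hn heven hx => ?_⟩
  have hn₂ : 0 ≤ n - 2 := by omega
  have hstep := h.isOrbit_iterVec.add_two hn₂ (heven.sub even_two)
  rw [sub_add_cancel] at hstep
  rw [hstep]
  refine H _ (h.isOrbit_iterVec.mem_cube _ hn₂) ?_ ?_
  · rw [h.toFace_iterVec_three (by omega)]
    exact h.mem_Ioo hn₂ _ _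
  · rwa [← hstep, h.toFace_iterVec_one (by omega)]

theorem exists_tendsto_of_opponent_interior {η : ℝ} (hη : 0 < η) (i s : Fin 2) {κ : ℝ}
    (hκ : 0 < κ) :
    ∃ δ > 0, ∀ x, IsOMWU η x → ∀ n : ℤ, 0 ≤ n → x n i s < δ →
      (∀ j, j ≠ i → ∀ s', κ ≤ x n j s') → Tendsto (fun t => x t i s) atTop (𝓝 0) := by
  obtain ⟨δ, hδ, H⟩ := exists_isOrbit_tendsto_of_le_oppVar hη (mul_pos hκ hκ)
  refine ⟨δ, hδ, fun x h n hn hx hopp => ?_⟩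
  have hne : 1 + i ≠ i := by fin_cases i <;> decide
  have hlim := H _ (h.isOrbit_iterVec.toFace i s) n hn
  simp only [oppVar, h.toFace_iterVec_one (n := n) (by omega),
    h.toFace_iterVec_three (n := n) (by omega), h.one_sub_eq (n := n) (by omega)] at hlim
  refine (hlim hx (mul_le_mul (hopp _ hne _) (hopp _ hne _) hκ.le (h.pos hn _ _).le)).congr' ?_
  filter_upwards [eventually_ge_atTop 0] with t ht using h.toFace_iterVec_one (by omega) i s

theorem exists_tendsto_some_player {η : ℝ} (hη : 0 < η) (i s : Fin 2) :
    ∃ δ > 0, ∀ x, IsOMWU η x → ∀ n : ℤ, 0 ≤ n → x n i s < δ →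
      Tendsto (fun t => x t i s) atTop (𝓝 0) ∨
        ∃ j, j ≠ i ∧ ∃ s', Tendsto (fun t => x t j s') atTop (𝓝 0) := by
  obtain ⟨δ, hδ, H⟩ := exists_isOrbit_tendsto_or_tendsto hη
  refine ⟨δ, hδ, fun x h n hn hx => ?_⟩
  have hne : 1 + i ≠ i := by fin_cases i <;> decide
  have hnonneg : ∀ᶠ t : ℤ in atTop, 0 ≤ t := eventually_ge_atTop 0
  rw [← h.toFace_iterVec_one (by omega)] at hx
  refine (H _ (h.isOrbit_iterVec.toFace i s) n hn hx).imp (fun hlim => ?_) fun ⟨l, hl, hlim⟩ => ?_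
  · exact hlim.congr' (hnonneg.mono fun t ht => h.toFace_iterVec_one (by omega) i s)
  have hlim : Tendsto (fun t => x t (1 + i) (s + i)) atTop (𝓝 l) :=
    hlim.congr' (hnonneg.mono fun t ht => h.toFace_iterVec_three (by omega) i s)
  refine ⟨1 + i, hne, ?_⟩
  obtain rfl | hl := mul_eq_zero.1 hl
  · exact ⟨_, hlim⟩
  · refine ⟨1 + (s + i), (hl ▸ hlim.const_sub 1).congr' ?_⟩
    exact hnonneg.mono fun t ht => h.one_sub_eq (by omega) _ _

end PeriodicOMWU

theorem mainTheorem4 (η : ℝ) (hη : 0 < η) :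
    -- two steps of the dynamics, from an even time, are one application of `G₁ ∘ G₂`
    (∀ x, PeriodicOMWU.IsOMWU η x → ∀ n : ℤ, 0 ≤ n → Even n →
      PeriodicOMWU.iterVec x (n + 2) =
        (PeriodicOMWU.G₁ η ∘ PeriodicOMWU.G₂ η) (PeriodicOMWU.iterVec x n)) ∧
    -- on each of the four faces: player `i` does not use strategy `s`
    ∀ i s : Fin 2,
      -- every point of the family is fixed
      (∀ a ∈ Set.Icc (0 : ℝ) 1,
        Function.IsFixedPt (PeriodicOMWU.G₁ η ∘ PeriodicOMWU.G₂ η)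
          (PeriodicOMWU.facePoint η i s a)) ∧
      -- the Jacobian has the eigenvalues `0, 0, 1` and a value below `1`
      (∀ a ∈ Set.Ioo (0 : ℝ) 1,
        DifferentiableAt ℝ (PeriodicOMWU.G₁ η ∘ PeriodicOMWU.G₂ η)
          (PeriodicOMWU.facePoint η i s a) ∧
        (PeriodicOMWU.jacobian (PeriodicOMWU.G₁ η ∘ PeriodicOMWU.G₂ η)
          (PeriodicOMWU.facePoint η i s a)).charpoly =
            X ^ 2 * (X - 1) * (X - C (PeriodicOMWU.fourthEigenvalue η a)) ∧
        0 < PeriodicOMWU.fourthEigenvalue η a ∧ PeriodicOMWU.fourthEigenvalue η a < 1) ∧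
      -- an iterate vector near the face is near a point of the family
      (∀ ε > 0, ∃ δ > 0, ∀ x, PeriodicOMWU.IsOMWU η x → ∀ n : ℤ, 2 ≤ n → Even n →
        x (n - 1) i s < δ → x n i s < δ →
          ∃ a ∈ Set.Ioo (0 : ℝ) 1,
            dist (PeriodicOMWU.iterVec x n) (PeriodicOMWU.facePoint η i s a) < ε) ∧
      -- from a neighborhood of each point of the family, the two entries of player `i` tend to
      -- their values on the face
      (∀ a ∈ Set.Ioo (0 : ℝ) 1, ∃ ρ > 0, ∀ z : Fin 4 → ℝ, (∀ k, z k ∈ Set.Icc (0 : ℝ) 1) →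
        dist z (PeriodicOMWU.facePoint η i s a) < ρ → ∀ r : Fin 2,
          Tendsto
            (fun t : ℕ => ((PeriodicOMWU.G₁ η ∘ PeriodicOMWU.G₂ η)^[t] z) (PeriodicOMWU.coord i r))
            atTop (𝓝 (![0, 1] s))) ∧
      -- a trajectory that comes close to the face, the opponent being `κ`-far from the boundary,
      -- converges to the face, and the KL-divergence to the equilibrium tends to infinity
      (∀ κ > 0, ∃ δ > 0, ∀ x, PeriodicOMWU.IsOMWU η x → ∀ n : ℤ, 0 ≤ n →
        x (n - 1) i s < δ → x n i s < δ → (∀ j, j ≠ i → ∀ s', κ ≤ x n j s') →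
          Tendsto (fun t : ℤ => x t i s) atTop (𝓝 0) ∧
          Tendsto (fun t : ℤ => PeriodicOMWU.KL PeriodicOMWU.equilibrium (x t)) atTop atTop) ∧
      -- without any condition on the opponent, at least one of the players converges to the
      -- boundary, and the KL-divergence to the equilibrium tends to infinity
      (∃ δ > 0, ∀ x, PeriodicOMWU.IsOMWU η x → ∀ n : ℤ, 0 ≤ n →
        x (n - 1) i s < δ → x n i s < δ →
          (Tendsto (fun t : ℤ => x t i s) atTop (𝓝 0) ∨
            ∃ j, j ≠ i ∧ ∃ s', Tendsto (fun t : ℤ => x t j s') atTop (𝓝 0)) ∧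
          Tendsto (fun t : ℤ => PeriodicOMWU.KL PeriodicOMWU.equilibrium (x t)) atTop atTop) := by
  refine ⟨fun x h n hn heven => h.isOrbit_iterVec.add_two hn heven, fun i s =>
    ⟨fun a ha => PeriodicOMWU.isFixedPt_facePoint η i s ha, fun a ha => ?_, fun ε hε => ?_,
      fun a ha => PeriodicOMWU.exists_tendsto_near_facePoint hη i s ha, fun κ hκ => ?_, ?_⟩⟩
  · have ha' := Set.Ioo_subset_Icc_self ha
    exact ⟨PeriodicOMWU.differentiableAt_twoStep η (PeriodicOMWU.facePoint_mem_cube η i s ha'),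
      PeriodicOMWU.charpoly_jacobian_facePoint η i s ha', Real.exp_pos _,
      PeriodicOMWU.fourthEigenvalue_lt_one hη ha⟩
  · obtain ⟨δ, hδ, hnear⟩ := PeriodicOMWU.exists_dist_iterVec_facePoint_lt η i s hε
    exact ⟨δ, hδ, fun x h n hn heven _ hx => hnear x h n hn heven hx⟩
  · obtain ⟨δ, hδ, hconv⟩ := PeriodicOMWU.exists_tendsto_of_opponent_interior hη i s hκ
    refine ⟨δ, hδ, fun x h n hn _ hx hopp => ?_⟩
    have hlim := hconv x h n hn hx hopp
    exact ⟨hlim, h.tendsto_KL hlim⟩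
  · obtain ⟨δ, hδ, hconv⟩ := PeriodicOMWU.exists_tendsto_some_player hη i s
    refine ⟨δ, hδ, fun x h n hn _ hx => ⟨hconv x h n hn hx, ?_⟩⟩
    obtain hlim | ⟨j, -, s', hlim⟩ := hconv x h n hn hx
    exacts [h.tendsto_KL hlim, h.tendsto_KL hlim]
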